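/- Let $n,m\ge 1$. For $k=0,\dots,m$ let $q_k(x)=\tfrac12\langle x,A_kx\rangle-\langle b_k,x\rangle+c_k$ on $\mathbb{R}^n$, with $A_k$ real symmetric, $b_k\in\mathbb{R}^n$, $c_k\in\mathbb{R}$; put $q=(q_1,\dots,q_m)$, $A(\sigma)=A_0+\sum_{i=1}^m\sigma_iA_i$ and $b(\sigma)=b_0+\sum_{i=1}^m\sigma_ib_i$ for $\sigma\in\mathbb{R}^m$. Let $V:\mathbb{R}^m\to\mathbb{R}\cup\{+\infty\}$ be a proper lower semicontinuous convex function of Legendre type (essentially smooth and essentially strictly convex) that is twice differentiable with positive definite Hessian on $\operatorname{int}(\operatorname{dom}V)$, and let $V^*$ be its Fenchel conjugate. Set \[ f(x)=q_0(x)+V(q(x)),\qquad \Xi(x,\sigma)=q_0(x)+\langle q(x),\sigma\rangle-V^*(\sigma), \] and let $D(\sigma)=\Xi(x,\sigma)$ for any $x$ with $A(\sigma)x=b(\sigma)$, be defined on $S_{\rm col}=\{\sigma\in\operatorname{dom}V^*\mid b(\sigma)\in\operatorname{Im}A(\sigma)\}$ (the value does not depend on the choice of $x$). Let $(\bar x,\bar\sigma)$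 be a critical point of $\Xi$ with $q(\bar x)\in\operatorname{int}(\operatorname{dom}V)$, $\bar\sigma\in\operatorname{dom}V^*$ and $A(\bar\sigma)\prec0$. Let $E\in\mathbb{R}^{n\times n}$ and $F\in\mathbb{R}^{m\times m}$ satisfy $E^*E=-A(\bar\sigma)$ and $F^*F=\nabla^2V(q(\bar x))$ (so $E,F$ are nonsingular), put $d_i=(E^{-1})^*(A_i\bar x-b_i)$ for $i=1,\dots,m$, $Jv=\sum_{i=1}^mv_id_i$ for $v\in\mathbb{R}^m$, and $H=J\circ F^*:\mathbb{R}^m\to\mathbb{R}^n$. Let $S_k$ be the Euclidean unit sphere of $\mathbb{R}^k$. Then: (i) If $\bar x$ is a local maximizer of $f$, or $\bar\sigma$ is a local maximizer of $D$, then $\|Hv\|\le1$ for all $v\in S_m$; equivalently $\beta\le1$, where $\beta=\max_{v\in S_m}\|Hv\|^2=\max_{u\in S_n}\|H^*u\|^2$. Conversely, if $\|Hv\|<1$ for all $v\in S_m$, then $\bar x$ and $\bar\sigma$ are local strict maximizers of $f$ and $D$, respectively. In particular, this is so if $A_i\bar x=b_i$ (equivalently $d_i=0$) for all $i=1,\dots,m$.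 (ii) If $\bar x$ is a local minimizer of $f$, then $\|H^*u\|\ge1$ for all $u\in S_n$; in particular $H$ is surjective, $m\ge n$, and every positive eigenvalue of $H^*H$ is at least $1$. Conversely, if $\|H^*u\|>1$ for all $u\in S_n$, then $\bar x$ is a local strict minimizer of $f$; moreover, if in addition $m>n$, then $\bar\sigma$ is not a local extremum of $D$. (iii) If $\bar\sigma$ is a local minimizer of $D$, then $\|Hv\|\ge1$ for all $v\in S_m$; in particular $H$ is injective, $m\le n$, and every positive eigenvalue of $HH^*$ is at least $1$. Moreover, if in addition $m<n$ and $D$ is not constant near $\bar\sigma$, then $\bar x$ is not a local extremum of $f$. Conversely, if $\|Hv\|>1$ for all $v\in S_m$, then $\bar\sigma$ is a local strict minimizer of $D$; if in addition $m<n$, then $\bar x$ is not a local extremum of $f$. (iv) If $m=n$, $\{A_i\bar x-b_i\mid i=1,\dots,m\}$ is a basis of $\mathbb{R}^m$, and $\|Hv\|>1$ for all $v\in S_m$, then $\bar x$ and $\bar\sigma$ are local strict minimizers of $f$ and $D$, respectively. -/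

import Mathlib

open Filter Topology

noncomputable section

namespace CDT

/-- `ℝᵏ` with its Euclidean structure. -/
abbrev E (k : ℕ) : Type := EuclideanSpace ℝ (Fin k)

/-- A square matrix acting on `ℝᵏ`. -/
abbrev act {k : ℕ} (M : Matrix (Fin k) (Fin k) ℝ) : E k →L[ℝ] E k :=
  Matrix.toEuclideanCLM (n := Fin k) (𝕜 := ℝ) M

/-! ### Convex analysis of extended-real-valued functions on `ℝᵏ` -/

section Convex

variable {k : ℕ}

/-- The effective domain `{y | g y < ∞}`. -/
def dom (g : E k → EReal) : Set (E k) := {y | g y < ⊤}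

/-- The Fenchel conjugate. -/
def conj (g : E k → EReal) (σ : E k) : EReal :=
  ⨆ y : E k, ((inner ℝ y σ : ℝ) : EReal) - g y

/-- The subdifferential (empty outside the effective domain). -/
def subdiff (g : E k → EReal) (y : E k) : Set (E k) :=
  {σ | y ∈ dom g ∧ ∀ y' : E k, ((inner ℝ (y' - y) σ : ℝ) : EReal) ≤ g y' - g y}

/-- The class `Γ` of proper convex lower semicontinuous functions; convexity is convexity of the
epigraph. -/
structure IsGamma (g : E k → EReal) : Prop where
  dom_nonempty : (dom g).Nonempty
  ne_bot : ∀ y, g y ≠ ⊥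
  convex_epi : Convex ℝ {p : E k × ℝ | g p.1 ≤ (p.2 : EReal)}
  lsc : LowerSemicontinuous g

/-- The finite part of `g`; it is only used on (the interior of) the effective domain. -/
def re (g : E k → EReal) (y : E k) : ℝ := (g y).toReal

/-- Essential smoothness: the effective domain has nonempty interior, `g` is differentiable there,
and the norm of the gradient tends to infinity at the boundary of that interior. -/
structure IsEssSmooth (g : E k → EReal) : Prop where
  int_nonempty : (interior (dom g)).Nonempty
  diff : ∀ y ∈ interior (dom g), DifferentiableAt ℝ (re g) y
  blowup : ∀ z ∈ frontier (interior (dom g)),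
    Tendsto (fun y => ‖gradient (re g) y‖) (𝓝[interior (dom g)] z) atTop

/-- Essential strict convexity: `g` is strictly convex on every convex subset of
`dom ∂g`. -/
def IsEssStrictConvex (g : E k → EReal) : Prop :=
  ∀ C : Set (E k), Convex ℝ C → C ⊆ {y | (subdiff g y).Nonempty} → StrictConvexOn ℝ C (re g)

/-- The Hessian matrix, i.e. the matrix of the derivative of the gradient. -/
def hess (g : E k → EReal) (y : E k) : Matrix (Fin k) (Fin k) ℝ :=
  Matrix.of fun i j => fderiv ℝ (gradient (re g)) y (EuclideanSpace.single j 1) i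

/-- The class `Γ_sc` of proper lsc convex functions of Legendre type. -/
structure IsGammaSc (g : E k → EReal) : Prop where
  gamma : IsGamma g
  smooth : IsEssSmooth g
  strict : IsEssStrictConvex g

/-- The class `Γ_sc²`: Legendre type, twice differentiable on the interior of the effective domain,
with positive definite Hessian there. -/
structure IsGammaSc2 (g : E k → EReal) : Prop where
  legendre : IsGammaSc g
  twice : ∀ y ∈ interior (dom g), DifferentiableAt ℝ (gradient (re g)) y
  posDef : ∀ y ∈ interior (dom g), (hess g y).PosDef

end Convex

/-! ### The family of quadratic functions -/

/-- The data of quadratic functions `q_k(x) = ½⟨x, A_k x⟩ - ⟨b_k, x⟩ + c_k`, `k = 0, …, m`,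
on `ℝⁿ`. -/
structure QuadData (n m : ℕ) where
  A : Fin (m + 1) → Matrix (Fin n) (Fin n) ℝ
  b : Fin (m + 1) → E n
  c : Fin (m + 1) → ℝ
  symm : ∀ k, (A k).IsSymm

namespace QuadData

variable {n m : ℕ} (P : QuadData n m)

/-- The quadratic function `q_k`. -/
def quad (k : Fin (m + 1)) (x : E n) : ℝ :=
  1 / 2 * inner ℝ x (act (P.A k) x) - inner ℝ (P.b k) x + P.c k

/-- The vector `q(x) = (q_1(x), …, q_m(x))`. -/
def q (x : E n) : E m := WithLp.toLp 2 fun i : Fin m => P.quad i.succ x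

/-- `A(σ) = A_0 + ∑ σ_i A_i`. -/
def Aσ (σ : E m) : Matrix (Fin n) (Fin n) ℝ := P.A 0 + ∑ i : Fin m, σ i • P.A i.succ

/-- `b(σ) = b_0 + ∑ σ_i b_i`. -/
def bσ (σ : E m) : E n := P.b 0 + ∑ i : Fin m, σ i • P.b i.succ

/-- The Lagrangian `L(x, σ) = q_0(x) + ⟨q(x), σ⟩`. -/
def L (x : E n) (σ : E m) : ℝ := P.quad 0 x + inner ℝ (P.q x) σ

variable (V : E m → EReal)

/-- The objective function `f = q_0 + V ∘ q`. -/
def f (x : E n) : EReal := (P.quad 0 x : EReal) + V (P.q x)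

/-- The total complementary function `Ξ(x, σ) = L(x, σ) - V*(σ)`. -/
def Xi (x : E n) (σ : E m) : EReal := (P.L x σ : EReal) - conj V σ

/-- `X_0 = {x | q(x) ∈ int dom V}`. -/
def X0 : Set (E n) := {x | P.q x ∈ interior (dom V)}

/-- `S⁻ = {σ ∈ dom V* | A(σ) ≺ 0}`. -/
def Sneg : Set (E m) := {σ | (-P.Aσ σ).PosDef ∧ σ ∈ dom (conj V)}

/-- `S_col = {σ ∈ dom V* | b(σ) ∈ Im A(σ)}`. -/
def Scol : Set (E m) := {σ | (∃ x, act (P.Aσ σ) x = P.bσ σ) ∧ σ ∈ dom (conj V)}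

open Classical in
/-- The dual objective: `D(σ) = Ξ(x, σ)` with `A(σ) x = b(σ)`. It is meaningful on `S_col`,
and does not depend on the choice of `x`, see `D_eq`. -/
def D (σ : E m) : EReal :=
  if h : ∃ x, act (P.Aσ σ) x = P.bσ σ then P.Xi V h.choose σ else 0

/-- `(x, σ)` is a critical point of `Ξ`: `Ξ` is finite near `(x, σ)`, and it is differentiable
there with zero derivative. -/
def IsCritical (x : E n) (σ : E m) : Prop :=
  σ ∈ interior (dom (conj V)) ∧
    HasFDerivAt (𝕜 := ℝ) (fun p : E n × E m => (P.Xi V p.1 p.2).toReal) 0 (x, σ)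

/-- `d_i = (E⁻¹)* (A_i x - b_i)`. -/
def d (M : Matrix (Fin n) (Fin n) ℝ) (x : E n) (i : Fin m) : E n :=
  act (M⁻¹).transpose (act (P.A i.succ) x - P.b i.succ)

/-- `J v = ∑ v_i d_i`. -/
def J (M : Matrix (Fin n) (Fin n) ℝ) (x : E n) : E m →L[ℝ] E n :=
  ∑ i : Fin m, (EuclideanSpace.proj i : E m →L[ℝ] ℝ).smulRight (P.d M x i)

/-- The operator `H = J ∘ F*`. -/
def H (M : Matrix (Fin n) (Fin n) ℝ) (F : Matrix (Fin m) (Fin m) ℝ) (x : E n) :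
    E m →L[ℝ] E n :=
  (P.J M x).comp (act F.transpose)

/-- The Lagrangian in terms of `A(σ)`, `b(σ)` and `c(σ)`. -/
theorem L_eq (x : E n) (σ : E m) :
    P.L x σ = 1 / 2 * inner ℝ x (act (P.Aσ σ) x) - inner ℝ (P.bσ σ) x
      + (P.c 0 + ∑ i : Fin m, σ i * P.c i.succ) := by
  have h : inner ℝ (P.q x) σ = ∑ i : Fin m, σ i * P.quad i.succ x := by
    simp [PiLp.inner_apply, q]
  rw [L, h]
  simp only [quad, Aσ, bσ, act, map_add, map_sum, map_smul, add_apply,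
    sum_apply, smul_apply, inner_add_right, inner_sum,
    inner_smul_right, inner_add_left, sum_inner, inner_smul_left, mul_add, mul_sub,
    Finset.sum_add_distrib, Finset.sum_sub_distrib, Finset.mul_sum]
  have e : ∀ i : Fin m, (1 / 2 : ℝ) * (σ i * inner ℝ x
      (Matrix.toEuclideanCLM (n := Fin n) (𝕜 := ℝ) (P.A i.succ) x)) = σ i * (1 / 2 * inner ℝ x
      (Matrix.toEuclideanCLM (n := Fin n) (𝕜 := ℝ) (P.A i.succ) x)) := fun i => by ring
  simp only [e, conj_trivial]
  ring

/-- `A(σ)` is self-adjoint. -/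
theorem inner_Aσ (σ : E m) (x y : E n) :
    inner ℝ (act (P.Aσ σ) x) y = inner ℝ x (act (P.Aσ σ) y) := by
  have hs : (P.Aσ σ).conjTranspose = P.Aσ σ := by
    simp [Aσ, Matrix.conjTranspose_eq_transpose_of_trivial, Matrix.transpose_sum, (P.symm _).eq]
  have h : ContinuousLinearMap.adjoint (act (P.Aσ σ)) = act (P.Aσ σ) := by
    rw [← ContinuousLinearMap.star_eq_adjoint, ← map_star, Matrix.star_eq_conjTranspose, hs]
  rw [← ContinuousLinearMap.adjoint_inner_right, h]

/-- `D(σ)` does not depend on the solution `x` of `A(σ) x = b(σ)`. -/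
theorem D_eq (σ : E m) (x : E n) (hx : act (P.Aσ σ) x = P.bσ σ) : P.D V σ = P.Xi V x σ := by
  have h : ∃ x, act (P.Aσ σ) x = P.bσ σ := ⟨x, hx⟩
  have hy := h.choose_spec
  rw [D, dif_pos h]
  generalize h.choose = y at hy
  have e : P.L y σ = P.L x σ := by
    have h1 : inner ℝ (P.bσ σ) y = inner ℝ (P.bσ σ) x := by
      calc inner ℝ (P.bσ σ) y = inner ℝ (act (P.Aσ σ) x) y := by rw [hx]
        _ = inner ℝ x (act (P.Aσ σ) y) := P.inner_Aσ σ x y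
        _ = inner ℝ (P.bσ σ) x := by rw [hy, real_inner_comm]
    rw [L_eq, L_eq, hx, hy, real_inner_comm (P.bσ σ) y, real_inner_comm (P.bσ σ) x, h1]
  rw [Xi, Xi, e]

end QuadData

/-- `x` is a local strict maximizer of `g` over `S`. -/
def IsStrictLocalMaxOn {X : Type*} [TopologicalSpace X] (g : X → EReal) (S : Set X) (x : X) :
    Prop :=
  ∀ᶠ y in 𝓝[S \ {x}] x, g y < g x

/-- `x` is a local strict minimizer of `g` over `S`. -/
def IsStrictLocalMinOn {X : Type*} [TopologicalSpace X] (g : X → EReal) (S : Set X) (x : X) :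
    Prop :=
  ∀ᶠ y in 𝓝[S \ {x}] x, g x < g y

end CDT

end

/-! Criticality of `Ξ` gives `A(σ)x = b(σ)` and `∇V*(σ) = q(x)`; equality in Fenchel–Young then
yields `σ = ∇V(q(x))`. Hence `f(y) = L(y,σ) + [V(q(y)) - ⟨q(y),σ⟩]`, where the first term is exactly
quadratic with Hessian `-E*E` and the second contributes `½‖F q'(x)z‖²` to second order. In the
coordinate `w = Ez` this makes the quadratic form of `f` equal to `‖H*w‖² - ‖w‖²`.

Dually, `D(τ) = L(x_τ,τ) - V*(τ)` with `A(τ)x_τ = b(τ)`. The first term contributes `½‖Jδ‖²`, and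
`V*` has the inverse Hessian, so with `δ = F*w` the quadratic form of `D` is `‖Hw‖² - ‖w‖²`
(`local_analysis`). Almost everything then reduces to comparing `‖H·‖` and `‖H*·‖` with `‖·‖`
(`optimality_conditions`): upper bounds pass between `H` and `H*`, while lower bounds give
injectivity of one, surjectivity of the other and dimension inequalities.

The degenerate case in (iii) needs a further argument: by Fenchel–Young `D(τ) ≤ f(x_τ)`, with
equality at `σ`, so a local maximum of `f` forces one of `D`.

`V` is not assumed C², so all expansions are of Peano type at a single point, and that of `V*`
(`IsGamma.hasExpansion_conj`) comes from convexity and compactness instead of the inverse function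
theorem. -/

noncomputable section

namespace CDT

/-! ### Second-order Peano expansions and local extrema. -/

section Expansion

set_option linter.unusedSectionVars false

variable {X : Type*} [NormedAddCommGroup X] [InnerProductSpace ℝ X]

/-- `g` has the second order expansion `g y = g x + ½ Q (y - x) + o(‖y - x‖²)` at the critical
point `x`. -/
def HasExpansion (g : X → ℝ) (x : X) (Q : X → ℝ) : Prop :=
  ∀ ε > 0, ∀ᶠ y in 𝓝 x, |g y - g x - 1 / 2 * Q (y - x)| ≤ ε * ‖y - x‖ ^ 2

theorem HasExpansion.neg {g : X → ℝ} {x : X} {Q : X → ℝ} (h : HasExpansion g x Q) :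
    HasExpansion (fun y => -g y) x (fun v => -Q v) := by
  intro ε hε
  filter_upwards [h ε hε] with y hy
  rw [← abs_neg] at hy
  convert hy using 2
  ring

/-- A direction of positive curvature excludes a local maximum. -/
theorem HasExpansion.not_isLocalMax {g : X → ℝ} {x : X} {Q : X → ℝ} (h : HasExpansion g x Q)
    (hQ : ∀ (t : ℝ) (v : X), Q (t • v) = t ^ 2 * Q v) {v : X} (hv : 0 < Q v) :
    ¬ IsLocalMax g x := by
  intro hmax
  have hv0 : v ≠ 0 := by
    rintro rfl
    have := hQ 0 0
    simp at this
    linarith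
  have hn : 0 < ‖v‖ ^ 2 := by positivity
  -- The error at `x + t • v` is then `t² Q v / 4`, half of the second-order gain `t² Q v / 2`.
  set ε : ℝ := Q v / (4 * ‖v‖ ^ 2) with hε
  have hε0 : 0 < ε := by positivity
  have hlim : Tendsto (fun t : ℝ => x + t • v) (𝓝[>] 0) (𝓝 x) := by
    have : Continuous fun t : ℝ => x + t • v := by fun_prop
    have := this.tendsto 0
    simp only [zero_smul, add_zero] at this
    exact this.mono_left nhdsWithin_le_nhds
  obtain ⟨t, ⟨h1, h2⟩, ht⟩ :=
    ((hlim.eventually ((h ε hε0).and hmax)).and self_mem_nhdsWithin).exists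
  have ht : 0 < t := ht
  rw [add_sub_cancel_left, hQ, norm_smul, mul_pow, Real.norm_eq_abs, sq_abs] at h1
  have e : ε * (t ^ 2 * ‖v‖ ^ 2) = t ^ 2 * Q v / 4 := by
    rw [hε]; field_simp
  rw [e] at h1
  have := (abs_le.1 h1).1
  have : 0 < t ^ 2 * Q v := by positivity
  have h2 : g (x + t • v) ≤ g x := h2
  linarith

theorem HasExpansion.not_isLocalMin {g : X → ℝ} {x : X} {Q : X → ℝ} (h : HasExpansion g x Q)
    (hQ : ∀ (t : ℝ) (v : X), Q (t • v) = t ^ 2 * Q v) {v : X} (hv : Q v < 0) :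
    ¬ IsLocalMin g x := fun hmin =>
  h.neg.not_isLocalMax (v := v) (fun t v => by simp [hQ]) (by simpa using hv) hmin.neg

/-- A uniformly positive definite second order term gives quadratic growth. -/
theorem HasExpansion.growth {g : X → ℝ} {x : X} {Q : X → ℝ} (h : HasExpansion g x Q)
    {c : ℝ} (hc : 0 < c) (hQ : ∀ v, c * ‖v‖ ^ 2 ≤ Q v) :
    ∀ᶠ y in 𝓝 x, g x + c / 4 * ‖y - x‖ ^ 2 ≤ g y := by
  filter_upwards [h (c / 4) (by positivity)] with y hy
  have := (abs_le.1 hy).1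
  have := hQ (y - x)
  linarith

/-- The constant is the minimum of `Q` on the compact unit sphere, spread by homogeneity; the sphere
is empty when the space is trivial. -/
theorem exists_pos_lower_bound [FiniteDimensional ℝ X] {Q : X → ℝ} (hc : Continuous Q)
    (hQ : ∀ (t : ℝ) (v : X), Q (t • v) = t ^ 2 * Q v) (hpos : ∀ v ≠ 0, 0 < Q v) :
    ∃ c > 0, ∀ v, c * ‖v‖ ^ 2 ≤ Q v := by
  have hQ0 : Q 0 = 0 := by simpa using hQ 0 0
  rcases (Metric.sphere (0 : X) 1).eq_empty_or_nonempty with he | hne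
  · refine ⟨1, one_pos, fun v => ?_⟩
    rcases eq_or_ne v 0 with rfl | hv
    · simp [hQ0]
    · have : (‖v‖⁻¹ • v) ∈ Metric.sphere (0 : X) 1 := by
        simp [norm_smul, hv]
      rw [he] at this
      exact this.elim
  · obtain ⟨u, hu, hmin⟩ := (isCompact_sphere (0 : X) 1).exists_isMinOn hne hc.continuousOn
    have hu0 : u ≠ 0 := by
      rintro rfl
      simp at hu
    refine ⟨Q u, hpos u hu0, fun v => ?_⟩
    rcases eq_or_ne v 0 with rfl | hv
    · simp [hQ0]
    · have hmem : (‖v‖⁻¹ • v) ∈ Metric.sphere (0 : X) 1 := by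
        simp [norm_smul, hv]
      have h1 : Q u ≤ Q (‖v‖⁻¹ • v) := hmin hmem
      have hn : 0 < ‖v‖ := norm_pos_iff.2 hv
      calc Q u * ‖v‖ ^ 2 ≤ Q (‖v‖⁻¹ • v) * ‖v‖ ^ 2 := by gcongr
        _ = Q v := by rw [hQ]; field_simp

theorem HasExpansion.eventually_lt [FiniteDimensional ℝ X] {g : X → ℝ} {x : X} {Q : X → ℝ}
    (h : HasExpansion g x Q) (hc : Continuous Q)
    (hQ : ∀ (t : ℝ) (v : X), Q (t • v) = t ^ 2 * Q v) (hpos : ∀ v ≠ 0, 0 < Q v) :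
    ∀ᶠ y in 𝓝[≠] x, g x < g y := by
  obtain ⟨c, hc0, hcQ⟩ := exists_pos_lower_bound hc hQ hpos
  filter_upwards [nhdsWithin_le_nhds (h.growth hc0 hcQ), self_mem_nhdsWithin] with y hy hne
  have : 0 < ‖y - x‖ := norm_pos_iff.2 (sub_ne_zero.2 hne)
  have : 0 < c / 4 * ‖y - x‖ ^ 2 := by positivity
  linarith

theorem HasExpansion.eventually_gt [FiniteDimensional ℝ X] {g : X → ℝ} {x : X} {Q : X → ℝ}
    (h : HasExpansion g x Q) (hc : Continuous Q)
    (hQ : ∀ (t : ℝ) (v : X), Q (t • v) = t ^ 2 * Q v) (hneg : ∀ v ≠ 0, Q v < 0) :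
    ∀ᶠ y in 𝓝[≠] x, g y < g x := by
  filter_upwards [h.neg.eventually_lt hc.neg (fun t v => by simp [hQ])
    (fun v hv => by simpa using hneg v hv)] with y hy
  simpa using hy

/-- Taylor's formula of order two at a point where the gradient is differentiable. -/
theorem hasExpansion_of_gradient [CompleteSpace X] {g : X → ℝ} {x : X} {G : X → X}
    {B : X →L[ℝ] X} (hg : ∀ᶠ y in 𝓝 x, HasGradientAt g (G y) y) (hB : HasFDerivAt G B x)
    (hsymm : ∀ u v, inner ℝ (B u) v = inner ℝ u (B v)) :
    HasExpansion (fun y => g y - inner ℝ y (G x)) x (fun v => inner ℝ v (B v)) := by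
  intro ε hε
  have h1 := hB.isLittleO.def hε
  obtain ⟨r, hr, hball⟩ := Metric.eventually_nhds_iff_ball.1 (hg.and h1)
  filter_upwards [Metric.ball_mem_nhds x hr] with y hy
  -- The mean value inequality is applied to the remainder `ψ`. By symmetry of `B` its gradient at
  -- `z` is `G z - G x - B (z - x)`, which is small by differentiability of `G` at the single point
  -- `x`.
  set ψ : X → ℝ := fun y => g y - inner ℝ y (G x) - 1 / 2 * inner ℝ (y - x) (B (y - x)) with hψ
  have hder : ∀ z ∈ Metric.closedBall x ‖y - x‖, HasFDerivWithinAt ψ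
      ((InnerProductSpace.toDual ℝ X) (G z - G x - B (z - x))) (Metric.closedBall x ‖y - x‖) z := by
    intro z hz
    have hz' : z ∈ Metric.ball x r := by
      rw [Metric.mem_closedBall] at hz
      rw [Metric.mem_ball] at hy ⊢
      rw [← dist_eq_norm] at hz
      exact hz.trans_lt hy
    have hgz := (hball z hz').1.hasFDerivAt
    have hi : HasFDerivAt (fun y : X => (inner ℝ y (G x) : ℝ))
        (InnerProductSpace.toDual ℝ X (G x)) z := by
      have := (InnerProductSpace.toDual ℝ X (G x)).hasFDerivAt (x := z)
      refine this.congr_of_eventuallyEq (Eventually.of_forall fun y => ?_)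
      simp [real_inner_comm]
    have hs : HasFDerivAt (fun y : X => y - x) (ContinuousLinearMap.id ℝ X) z :=
      (hasFDerivAt_id z).sub_const x
    have hq := (hs.inner ℝ (B.hasFDerivAt.comp z hs)).const_mul (1 / 2 : ℝ)
    refine ((hgz.sub hi).sub hq).hasFDerivWithinAt.congr_fderiv ?_
    ext v
    simp only [map_sub, sub_apply, InnerProductSpace.toDual_apply_apply,
      smul_apply, ContinuousLinearMap.comp_apply,
      fderivInnerCLM_apply, ContinuousLinearMap.prod_apply, ContinuousLinearMap.id_apply,
      smul_eq_mul, Function.comp_apply]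
    have e1 : inner ℝ (z - x) (B v) = inner ℝ (B z - B x) v := by rw [← hsymm, map_sub]
    have e2 : inner ℝ v (B z - B x) = inner ℝ (B z - B x) v := real_inner_comm _ _
    simp only [e1, e2]
    rw [inner_sub_left (B z) (B x) v]
    ring
  have hbd : ∀ z ∈ Metric.closedBall x ‖y - x‖,
      ‖(InnerProductSpace.toDual ℝ X) (G z - G x - B (z - x))‖ ≤ ε * ‖y - x‖ := by
    intro z hz
    rw [Metric.mem_closedBall, dist_eq_norm] at hz
    have hz' : z ∈ Metric.ball x r := by
      rw [Metric.mem_ball, dist_eq_norm] at hy ⊢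
      exact hz.trans_lt hy
    rw [LinearIsometryEquiv.norm_map]
    exact ((hball z hz').2).trans (by gcongr)
  have := (convex_closedBall x ‖y - x‖).norm_image_sub_le_of_norm_hasFDerivWithin_le hder hbd
    (Metric.mem_closedBall_self (norm_nonneg _))
    (show y ∈ _ by rw [Metric.mem_closedBall, dist_eq_norm])
  rw [Real.norm_eq_abs] at this
  calc _ = |ψ y - ψ x| := by
        congr 1
        simp [hψ]
        ring
    _ ≤ ε * ‖y - x‖ * ‖y - x‖ := this
    _ = _ := by ring

/-- A convex function lies above its tangents. -/
theorem _root_.ConvexOn.add_fderiv_le {s : Set X} {g : X → ℝ} (hg : ConvexOn ℝ s g) {x y : X}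
    (hx : x ∈ s) (hy : y ∈ s) {g' : X →L[ℝ] ℝ} (h : HasFDerivAt g g' x) :
    g x + g' (y - x) ≤ g y := by
  have hl : HasDerivAt (fun t : ℝ => g (x + t • (y - x))) (g' (y - x)) 0 := by
    have := h.hasLineDerivAt (y - x)
    exact this
  have := hl.tendsto_slope_zero_right
  refine le_sub_iff_add_le'.1 (le_of_tendsto this ?_)
  filter_upwards [Ioo_mem_nhdsGT one_pos] with t ht
  have hconv := hg.2 hx hy (sub_nonneg.2 ht.2.le) ht.1.le (by ring)
  have e : (1 - t) • x + t • y = x + t • (y - x) := by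
    rw [smul_sub, sub_smul, one_smul]; abel
  rw [e] at hconv
  simp only [zero_add, zero_smul, add_zero, smul_eq_mul] at hconv ⊢
  rw [inv_mul_le_iff₀ ht.1]
  linarith

end Expansion

/-! ### Fenchel conjugates in real-valued form, and their second-order expansion. -/

section Conjugate

variable {k : ℕ} {V : E k → EReal}

theorem IsGamma.coe_re (hV : IsGamma V) {y : E k} (hy : y ∈ dom V) : (re V y : EReal) = V y :=
  EReal.coe_toReal (ne_of_lt hy) (hV.ne_bot y)

theorem IsGamma.convexOn_re (hV : IsGamma V) : ConvexOn ℝ (dom V) (re V) := by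
  have key : ∀ y ∈ dom V, ∀ z ∈ dom V, ∀ a b : ℝ, 0 ≤ a → 0 ≤ b → a + b = 1 →
      V (a • y + b • z) ≤ ((a * re V y + b * re V z : ℝ) : EReal) := by
    intro y hy z hz a b ha hb hab
    have h1 : (y, re V y) ∈ {p : E k × ℝ | V p.1 ≤ (p.2 : EReal)} := (hV.coe_re hy).ge
    have h2 : (z, re V z) ∈ {p : E k × ℝ | V p.1 ≤ (p.2 : EReal)} := (hV.coe_re hz).ge
    exact hV.convex_epi h1 h2 ha hb hab
  refine ⟨fun y hy z hz a b ha hb hab => ?_, fun y hy z hz a b ha hb hab => ?_⟩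
  · exact (key y hy z hz a b ha hb hab).trans_lt (EReal.coe_lt_top _)
  · have h := key y hy z hz a b ha hb hab
    have hd : a • y + b • z ∈ dom V := h.trans_lt (EReal.coe_lt_top _)
    rw [← hV.coe_re hd, EReal.coe_le_coe_iff] at h
    exact h

/-- Points outside `dom V` contribute `⊥` to the supremum, so bounds on the conjugate become real
inequalities. -/
theorem IsGamma.conj_le_iff (hV : IsGamma V) {σ : E k} {c : ℝ} :
    conj V σ ≤ (c : EReal) ↔ ∀ y ∈ dom V, inner ℝ y σ - re V y ≤ c := by
  rw [conj, iSup_le_iff]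
  refine forall_congr' fun y => ?_
  by_cases hy : y ∈ dom V
  · rw [← hV.coe_re hy, ← EReal.coe_sub, EReal.coe_le_coe_iff]
    simp [hy]
  · have : V y = ⊤ := by simpa [dom] using hy
    simp [hy, this]

theorem IsGamma.conj_ne_bot (hV : IsGamma V) (σ : E k) : conj V σ ≠ ⊥ := by
  obtain ⟨y, hy⟩ := hV.dom_nonempty
  intro h
  have h1 : ((inner ℝ y σ : ℝ) : EReal) - V y ≤ conj V σ :=
    le_iSup (fun y : E k => ((inner ℝ y σ : ℝ) : EReal) - V y) y
  rw [h, ← hV.coe_re hy, ← EReal.coe_sub, le_bot_iff] at h1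
  exact EReal.coe_ne_bot _ h1

theorem IsGamma.coe_re_conj (hV : IsGamma V) {σ : E k} (hσ : σ ∈ dom (conj V)) :
    (re (conj V) σ : EReal) = conj V σ :=
  EReal.coe_toReal (ne_of_lt hσ) (hV.conj_ne_bot σ)

/-- The Fenchel–Young inequality. -/
theorem IsGamma.inner_sub_re_le (hV : IsGamma V) {y σ : E k} (hy : y ∈ dom V)
    (hσ : σ ∈ dom (conj V)) : inner ℝ y σ - re V y ≤ re (conj V) σ :=
  hV.conj_le_iff.1 (hV.coe_re_conj hσ).ge y hy

theorem IsGamma.re_conj_le (hV : IsGamma V) {σ : E k} {c : ℝ}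
    (h : ∀ y ∈ dom V, inner ℝ y σ - re V y ≤ c) : σ ∈ dom (conj V) ∧ re (conj V) σ ≤ c := by
  have h1 := hV.conj_le_iff.2 h
  have hd : σ ∈ dom (conj V) := h1.trans_lt (EReal.coe_lt_top _)
  rw [← hV.coe_re_conj hd, EReal.coe_le_coe_iff] at h1
  exact ⟨hd, h1⟩

theorem IsGamma.re_conj_eq (hV : IsGamma V) {y σ : E k} (hy : y ∈ dom V)
    (h : ∀ z ∈ dom V, inner ℝ z σ - re V z ≤ inner ℝ y σ - re V y) :
    σ ∈ dom (conj V) ∧ re (conj V) σ = inner ℝ y σ - re V y :=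
  have h1 := hV.re_conj_le h
  ⟨h1.1, le_antisymm h1.2 (hV.inner_sub_re_le hy h1.1)⟩

theorem IsGamma.convexOn_re_conj (hV : IsGamma V) : ConvexOn ℝ (dom (conj V)) (re (conj V)) := by
  have key : ∀ y ∈ dom (conj V), ∀ z ∈ dom (conj V), ∀ a b : ℝ, 0 ≤ a → 0 ≤ b → a + b = 1 →
      a • y + b • z ∈ dom (conj V) ∧
        re (conj V) (a • y + b • z) ≤ a * re (conj V) y + b * re (conj V) z := by
    intro y hy z hz a b ha hb hab
    refine hV.re_conj_le fun w hw => ?_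
    have h1 := mul_le_mul_of_nonneg_left (hV.inner_sub_re_le hw hy) ha
    have h2 := mul_le_mul_of_nonneg_left (hV.inner_sub_re_le hw hz) hb
    rw [inner_add_right, inner_smul_right, inner_smul_right]
    have : re V w = a * re V w + b * re V w := by rw [← add_mul, hab, one_mul]
    linarith
  exact ⟨fun y hy z hz a b ha hb hab => (key y hy z hz a b ha hb hab).1,
    fun y hy z hz a b ha hb hab => (key y hy z hz a b ha hb hab).2⟩

theorem IsGamma.convexOn_re_sub_inner (hV : IsGamma V) (σ : E k) :
    ConvexOn ℝ (dom V) (fun y => re V y - inner ℝ y σ) := by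
  refine ⟨hV.convexOn_re.1, fun y hy z hz a b ha hb hab => ?_⟩
  have := hV.convexOn_re.2 hy hz ha hb hab
  simp only [smul_eq_mul, inner_add_left, inner_smul_left, conj_trivial] at this ⊢
  linarith

/-- A local minimizer of `V - ⟨·, σ⟩` determines the conjugate at `σ`. -/
theorem IsGamma.re_conj_eq_of_isLocalMin (hV : IsGamma V) {y σ : E k} (hy : y ∈ dom V)
    (h : IsLocalMin (fun z => re V z - inner ℝ z σ) y) :
    σ ∈ dom (conj V) ∧ re (conj V) σ = inner ℝ y σ - re V y := by
  refine hV.re_conj_eq hy fun z hz => ?_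
  -- Convexity makes the local minimizer global, so the supremum defining the conjugate is attained
  -- at `y`.
  have := IsMinOn.of_isLocalMinOn_of_convexOn hy (h.on _) (hV.convexOn_re_sub_inner σ) hz
  have h2 : re V y - inner ℝ y σ ≤ re V z - inner ℝ z σ := this
  linarith

/-- The second order expansion of the conjugate: a quadratic form `‖T ·‖²` goes to the dual form. -/
theorem IsGamma.hasExpansion_conj (hV : IsGamma V) {y₀ s : E k} (hy : y₀ ∈ interior (dom V))
    (T : E k ≃L[ℝ] E k)
    (hexp : HasExpansion (fun y => re V y - inner ℝ y s) y₀ (fun v => ‖T v‖ ^ 2)) :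
    re (conj V) s = inner ℝ y₀ s - re V y₀ ∧ (∀ᶠ σ in 𝓝 s, σ ∈ dom (conj V)) ∧
      HasExpansion (fun σ => re (conj V) σ - inner ℝ y₀ σ) s
        (fun δ => ‖ContinuousLinearMap.adjoint (T.symm : E k →L[ℝ] E k) δ‖ ^ 2) := by
  -- With `R` the inverse adjoint of `T`, `⟨u, δ⟩ = ⟨T u, R δ⟩ ≤ ½‖T u‖² + ½‖R δ‖²`, with equality
  -- at `T u = R δ`; this is the duality of the two forms.
  set R : E k →L[ℝ] E k := ContinuousLinearMap.adjoint (T.symm : E k →L[ℝ] E k) with hR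
  have hRT : ∀ u δ, inner ℝ u δ = inner ℝ (T u) (R δ) := fun u δ => by
    rw [hR, ContinuousLinearMap.adjoint_inner_right]
    simp
  obtain ⟨c, hc, hgrow⟩ : ∃ c > 0, ∀ᶠ y in 𝓝 y₀,
      re V y₀ - inner ℝ y₀ s + c * ‖y - y₀‖ ^ 2 ≤ re V y - inner ℝ y s := by
    obtain ⟨c, hc, hcQ⟩ := exists_pos_lower_bound (X := E k) (Q := fun v => ‖T v‖ ^ 2)
      (by fun_prop) (fun t v => by simp [norm_smul, mul_pow])
      (fun v hv => by
        have : T v ≠ 0 := by simpa using hv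
        positivity)
    exact ⟨c / 4, by positivity, hexp.growth hc hcQ⟩
  have hdom₀ : y₀ ∈ dom V := interior_subset hy
  obtain ⟨r, hr, hball⟩ := Metric.nhds_basis_closedBall.eventually_iff.1
    (hgrow.and (isOpen_interior.mem_nhds hy))
  -- Minimize `V - ⟨·,σ⟩` on a small closed ball. Quadratic growth against the tilt `σ - s` keeps
  -- the minimizer within `‖σ - s‖ / c` of `y₀`, hence inside the ball, so it gives the exact value
  -- of the conjugate.
  have hmin : ∀ σ, ‖σ - s‖ < c * r → ∃ y ∈ dom V, c * ‖y - y₀‖ ≤ ‖σ - s‖ ∧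
      σ ∈ dom (conj V) ∧ re (conj V) σ = inner ℝ y σ - re V y := by
    intro σ hσ
    have hcont : ContinuousOn (fun z => re V z - inner ℝ z σ) (Metric.closedBall y₀ r) :=
      (hV.convexOn_re.continuousOn_interior.mono fun z hz => (hball hz).2).sub (by fun_prop)
    obtain ⟨y, hyb, hyr⟩ := (isCompact_closedBall y₀ r).exists_isMinOn
      ⟨y₀, Metric.mem_closedBall_self hr.le⟩ hcont
    have h1 : re V y - inner ℝ y σ ≤ re V y₀ - inner ℝ y₀ σ :=
      hyr (Metric.mem_closedBall_self hr.le)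
    have h2 := (hball hyb).1
    have h3 : c * ‖y - y₀‖ ^ 2 ≤ ‖y - y₀‖ * ‖σ - s‖ := by
      refine le_trans ?_ (real_inner_le_norm (y - y₀) (σ - s))
      simp only [inner_sub_left, inner_sub_right]
      linarith
    have h4 : c * ‖y - y₀‖ ≤ ‖σ - s‖ := by
      rcases (norm_nonneg (y - y₀)).eq_or_lt with h0 | h0
      · rw [← h0]; simp
      · refine le_of_mul_le_mul_left ?_ h0
        linarith
    have hdomy : y ∈ dom V := interior_subset (hball hyb).2
    refine ⟨y, hdomy, h4, hV.re_conj_eq_of_isLocalMin hdomy ?_⟩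
    refine hyr.isLocalMin (Metric.closedBall_mem_nhds_of_mem ?_)
    rw [Metric.mem_ball, dist_eq_norm]
    exact lt_of_mul_lt_mul_left (h4.trans_lt hσ) hc.le
  have hs : re (conj V) s = inner ℝ y₀ s - re V y₀ := by
    refine (hV.re_conj_eq_of_isLocalMin hdom₀ ?_).2
    filter_upwards [hgrow] with y hy
    have : 0 ≤ c * ‖y - y₀‖ ^ 2 := by positivity
    linarith
  have hnear : ∀ {ρ : ℝ}, 0 < ρ → ∀ᶠ σ in 𝓝 s, ‖σ - s‖ < ρ := fun hρ => by
    filter_upwards [Metric.ball_mem_nhds s hρ] with σ hσ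
    rwa [← dist_eq_norm]
  refine ⟨hs, (hnear (mul_pos hc hr)).mono fun σ hσ => ?_, fun ε hε => ?_⟩
  · obtain ⟨y, -, -, h, -⟩ := hmin σ hσ
    exact h
  set C : ℝ := ‖(T.symm : E k →L[ℝ] E k).comp R‖ with hC
  obtain ⟨r₁, hr₁, hb₁⟩ := Metric.eventually_nhds_iff_ball.1 (hexp (ε * c ^ 2) (by positivity))
  -- The test point maximizes the model `⟨u, σ - s⟩ - ½‖T u‖²`, and Fenchel–Young there gives the
  -- lower bound. The `+ 1` keeps the denominator nonzero.
  have hlow : ∀ᶠ σ in 𝓝 s, y₀ + T.symm (R (σ - s)) ∈ dom V ∧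
      |(re V (y₀ + T.symm (R (σ - s))) - inner ℝ (y₀ + T.symm (R (σ - s))) s) -
        (re V y₀ - inner ℝ y₀ s) - 1 / 2 * ‖R (σ - s)‖ ^ 2| ≤
          ε / (C ^ 2 + 1) * ‖T.symm (R (σ - s))‖ ^ 2 := by
    have hcont : Continuous fun σ => y₀ + T.symm (R (σ - s)) := by fun_prop
    have ht := hcont.tendsto s
    simp only [sub_self, map_zero, add_zero] at ht
    have hin : ∀ᶠ z in 𝓝 y₀, z ∈ interior (dom V) := isOpen_interior.mem_nhds hy
    filter_upwards [ht.eventually (hin.and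
      (hexp (ε / (C ^ 2 + 1)) (by positivity)))] with σ hσ
    refine ⟨interior_subset hσ.1, ?_⟩
    simpa using hσ.2
  filter_upwards [hnear (mul_pos hc hr), hnear (mul_pos hc hr₁), hlow] with σ h1 h2 h3
  obtain ⟨y, hyd, hyn, hσd, hσe⟩ := hmin σ h1
  have hk : ‖y - y₀‖ < r₁ := lt_of_mul_lt_mul_left (hyn.trans_lt h2) hc.le
  have hup := hb₁ y (by rwa [Metric.mem_ball, dist_eq_norm])
  rw [abs_le]
  constructor
  · have h4 := hV.inner_sub_re_le h3.1 hσd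
    have h5 := (abs_le.1 h3.2).2
    have h6 : ε / (C ^ 2 + 1) * ‖T.symm (R (σ - s))‖ ^ 2 ≤ ε * ‖σ - s‖ ^ 2 := by
      have : ‖T.symm (R (σ - s))‖ ≤ C * ‖σ - s‖ :=
        ((T.symm : E k →L[ℝ] E k).comp R).le_opNorm (σ - s)
      calc ε / (C ^ 2 + 1) * ‖T.symm (R (σ - s))‖ ^ 2
          ≤ ε / (C ^ 2 + 1) * (C * ‖σ - s‖) ^ 2 := by gcongr
        _ = ε * ‖σ - s‖ ^ 2 * (C ^ 2 / (C ^ 2 + 1)) := by ring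
        _ ≤ ε * ‖σ - s‖ ^ 2 * 1 := by
            gcongr
            rw [div_le_one (by positivity)]
            linarith
        _ = _ := mul_one _
    have h7 : inner ℝ (T.symm (R (σ - s))) (σ - s) = ‖R (σ - s)‖ ^ 2 := by
      rw [hRT]
      simp
    rw [inner_sub_right] at h7
    rw [inner_add_left] at h4 h5
    rw [hs]
    linarith
  -- Upper bound: the expansion of `V` at the true minimizer, then Young's inequality. The factor `c
  -- ^ 2` in the tolerance cancels `‖y - y₀‖ ≤ ‖σ - s‖ / c`.
  · have h5 := (abs_le.1 hup).1
    have h6 : ε * c ^ 2 * ‖y - y₀‖ ^ 2 ≤ ε * ‖σ - s‖ ^ 2 := by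
      calc ε * c ^ 2 * ‖y - y₀‖ ^ 2 = ε * (c * ‖y - y₀‖) ^ 2 := by ring
        _ ≤ _ := by gcongr
    have h7 : inner ℝ (y - y₀) (σ - s) ≤ 1 / 2 * ‖T (y - y₀)‖ ^ 2 + 1 / 2 * ‖R (σ - s)‖ ^ 2 := by
      rw [hRT]
      have := real_inner_le_norm (T (y - y₀)) (R (σ - s))
      nlinarith [sq_nonneg (‖T (y - y₀)‖ - ‖R (σ - s)‖)]
    simp only [inner_sub_left, inner_sub_right] at h7
    rw [hs, hσe]
    linarith

/-- If `y` is the gradient of `V*` at `σ` and `V` has gradient `s` at `y`, with `y ∈ ∂V*(s)`,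
then `σ = s`. -/
theorem IsGamma.eq_of_hasFDerivAt_conj (hV : IsGamma V) {y s σ : E k}
    (hy : y ∈ interior (dom V)) (hg : HasGradientAt (re V) s y) (hsd : s ∈ dom (conj V))
    (hs : re (conj V) s = inner ℝ y s - re V y) (hσ : σ ∈ dom (conj V))
    {g' : E k →L[ℝ] ℝ} (hg' : ∀ v, g' v = inner ℝ y v)
    (h : HasFDerivAt (re (conj V)) g' σ) : σ = s := by
  -- The tangent of `V*` at `σ`, evaluated at `s`, gives `V*(σ) ≤ ⟨y,σ⟩ - V(y)`. So `y` minimizes `V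
  -- - ⟨·,σ⟩`, and the first-order condition reads `s = σ`.
  have h1 := hV.convexOn_re_conj.add_fderiv_le hσ hsd h
  rw [hg', inner_sub_right, hs] at h1
  have hmin : IsLocalMin (fun z => re V z - inner ℝ z σ) y := by
    filter_upwards [isOpen_interior.mem_nhds hy] with z hz
    have := hV.inner_sub_re_le (interior_subset hz) hσ
    linarith
  have hi : HasFDerivAt (fun z : E k => (inner ℝ z σ : ℝ))
      (InnerProductSpace.toDual ℝ (E k) σ) y := by
    have := (InnerProductSpace.toDual ℝ (E k) σ).hasFDerivAt (x := y)
    refine this.congr_of_eventuallyEq (Eventually.of_forall fun y => ?_)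
    simp [real_inner_comm]
  have h0 := hmin.hasFDerivAt_eq_zero (hg.hasFDerivAt.sub hi)
  rw [← map_sub, LinearIsometryEquiv.map_eq_zero_iff, sub_eq_zero] at h0
  exact h0.symm

end Conjugate

/-! ### Calculus of expansions; quadratic functions. -/

section ExpansionRules

set_option linter.unusedSectionVars false

variable {X Y : Type*} [NormedAddCommGroup X] [InnerProductSpace ℝ X]
  [NormedAddCommGroup Y] [InnerProductSpace ℝ Y]

theorem HasExpansion.add {g h : X → ℝ} {x : X} {Q R : X → ℝ} (hg : HasExpansion g x Q)
    (hh : HasExpansion h x R) : HasExpansion (fun y => g y + h y) x (fun v => Q v + R v) := by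
  intro ε hε
  filter_upwards [hg (ε / 2) (by positivity), hh (ε / 2) (by positivity)] with y h1 h2
  rw [abs_le] at h1 h2 ⊢
  constructor <;> linarith [h1.1, h1.2, h2.1, h2.2]

/-- Composition with a map differentiable at the base point. -/
theorem HasExpansion.comp {g : Y → ℝ} {q : X → Y} {x : X} {G : X →L[ℝ] Y} (T : Y →L[ℝ] Y)
    (hg : HasExpansion g (q x) (fun v => ‖T v‖ ^ 2)) (hq : HasFDerivAt q G x) :
    HasExpansion (fun y => g (q y)) x (fun v => ‖T (G v)‖ ^ 2) := by
  intro ε hε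
  set K : ℝ := ‖G‖ + 1 with hK
  have hK0 : 0 < K := by positivity
  -- `‖T ·‖²` changes by at most `‖T‖ η · 2K‖T‖ · ‖y - x‖²`; `η ≤ 1` ensures that `q` grows at rate
  -- at most `K`.
  set η : ℝ := min 1 (ε / (2 * K * (‖T‖ ^ 2 + 1))) with hη
  have hη0 : 0 < η := by positivity
  filter_upwards [hq.continuousAt.eventually (hg (ε / (2 * K ^ 2)) (by positivity)),
    hq.isLittleO.def hη0] with y h1 h2
  have hGz : ‖G (y - x)‖ ≤ ‖G‖ * ‖y - x‖ := G.le_opNorm _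
  have hk : ‖q y - q x‖ ≤ K * ‖y - x‖ := by
    calc ‖q y - q x‖ = ‖(q y - q x - G (y - x)) + G (y - x)‖ := by rw [sub_add_cancel]
      _ ≤ ‖q y - q x - G (y - x)‖ + ‖G (y - x)‖ := norm_add_le _ _
      _ ≤ η * ‖y - x‖ + ‖G‖ * ‖y - x‖ := add_le_add h2 hGz
      _ ≤ 1 * ‖y - x‖ + ‖G‖ * ‖y - x‖ := by gcongr; exact min_le_left _ _
      _ = _ := by rw [hK]; ring
  have h3 : |‖T (q y - q x)‖ ^ 2 - ‖T (G (y - x))‖ ^ 2| ≤ ε * ‖y - x‖ ^ 2 := by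
    have e : ‖T (q y - q x)‖ ^ 2 - ‖T (G (y - x))‖ ^ 2 =
        (‖T (q y - q x)‖ - ‖T (G (y - x))‖) * (‖T (q y - q x)‖ + ‖T (G (y - x))‖) := by ring
    rw [e, abs_mul, abs_of_nonneg (by positivity : 0 ≤ ‖T (q y - q x)‖ + ‖T (G (y - x))‖)]
    have b1 : |‖T (q y - q x)‖ - ‖T (G (y - x))‖| ≤ ‖T‖ * (η * ‖y - x‖) := by
      refine (abs_norm_sub_norm_le _ _).trans ?_
      rw [← map_sub]
      exact (T.le_opNorm _).trans (by gcongr)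
    have b2 : ‖T (q y - q x)‖ + ‖T (G (y - x))‖ ≤ ‖T‖ * (2 * K * ‖y - x‖) := by
      have c1 : ‖T (q y - q x)‖ ≤ ‖T‖ * (K * ‖y - x‖) := (T.le_opNorm _).trans (by gcongr)
      have c2 : ‖T (G (y - x))‖ ≤ ‖T‖ * (K * ‖y - x‖) := by
        refine (T.le_opNorm _).trans ?_
        gcongr
        refine hGz.trans ?_
        gcongr
        linarith
      linarith
    calc _ ≤ ‖T‖ * (η * ‖y - x‖) * (‖T‖ * (2 * K * ‖y - x‖)) := by gcongr
      _ = η * (2 * K * ‖T‖ ^ 2) * ‖y - x‖ ^ 2 := by ring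
      _ ≤ ε / (2 * K * (‖T‖ ^ 2 + 1)) * (2 * K * (‖T‖ ^ 2 + 1)) * ‖y - x‖ ^ 2 := by
          gcongr
          · exact min_le_right _ _
          · linarith
      _ = ε * ‖y - x‖ ^ 2 := by field_simp
  have h4 : ε / (2 * K ^ 2) * ‖q y - q x‖ ^ 2 ≤ ε / 2 * ‖y - x‖ ^ 2 := by
    calc _ ≤ ε / (2 * K ^ 2) * (K * ‖y - x‖) ^ 2 := by gcongr
      _ = _ := by field_simp
  rw [abs_le] at h1 h3 ⊢
  constructor <;> linarith [h1.1, h1.2, h3.1, h3.2]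

/-- The derivative of a quadratic function. -/
theorem hasFDerivAt_quadratic {A : X →L[ℝ] X} (hA : ∀ u v, inner ℝ (A u) v = inner ℝ u (A v))
    (b : X) (c : ℝ) (x : X) :
    HasFDerivAt (fun y => 1 / 2 * inner ℝ y (A y) - inner ℝ b y + c) (innerSL ℝ (A x - b)) x := by
  have hq := ((hasFDerivAt_id x).inner ℝ (A.hasFDerivAt (x := x))).const_mul (1 / 2 : ℝ)
  refine ((hq.sub (innerSL ℝ b).hasFDerivAt).add_const c).congr_fderiv ?_
  ext v
  have e1 : inner ℝ x (A v) = inner ℝ (A x) v := (hA _ _).symm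
  have e2 : inner ℝ v (A x) = inner ℝ (A x) v := real_inner_comm _ _
  simp [fderivInnerCLM_apply, e1, e2]
  ring

theorem quadratic_add {A : X →L[ℝ] X} (hA : ∀ u v, inner ℝ (A u) v = inner ℝ u (A v))
    (b : X) (c : ℝ) (x z : X) :
    1 / 2 * inner ℝ (x + z) (A (x + z)) - inner ℝ b (x + z) + c =
      (1 / 2 * inner ℝ x (A x) - inner ℝ b x + c) + inner ℝ (A x - b) z +
        1 / 2 * inner ℝ z (A z) := by
  have e1 : inner ℝ x (A z) = inner ℝ (A x) z := (hA _ _).symm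
  have e2 : inner ℝ z (A x) = inner ℝ (A x) z := real_inner_comm _ _
  simp only [map_add, inner_add_left, inner_add_right, inner_sub_left, e1, e2]
  ring

end ExpansionRules

/-! ### Matrices as operators, and the expansion of `V`. -/

section Matrices

variable {k : ℕ}

theorem act_mul (A B : Matrix (Fin k) (Fin k) ℝ) (v : E k) : act (A * B) v = act A (act B v) := by
  rw [act, map_mul]
  rfl

theorem act_one (v : E k) : act (1 : Matrix (Fin k) (Fin k) ℝ) v = v := by
  rw [act, map_one]
  rfl

theorem adjoint_act (A : Matrix (Fin k) (Fin k) ℝ) :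
    ContinuousLinearMap.adjoint (act A) = act A.transpose := by
  rw [← ContinuousLinearMap.star_eq_adjoint, ← map_star, Matrix.star_eq_conjTranspose,
    Matrix.conjTranspose_eq_transpose_of_trivial]

theorem inner_act (A : Matrix (Fin k) (Fin k) ℝ) (u v : E k) :
    inner ℝ u (act A v) = inner ℝ (act A.transpose u) v := by
  rw [← adjoint_act, ContinuousLinearMap.adjoint_inner_left]

theorem inner_act_gram (A : Matrix (Fin k) (Fin k) ℝ) (v : E k) :
    inner ℝ v (act (A.transpose * A) v) = ‖act A v‖ ^ 2 := by
  rw [act_mul, inner_act, Matrix.transpose_transpose, real_inner_self_eq_norm_sq]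

theorem isUnit_det_of_gram {A B : Matrix (Fin k) (Fin k) ℝ} (h : A.transpose * A = B)
    (hB : B.PosDef) : IsUnit A.det := by
  have h1 : A.transpose.det * A.det ≠ 0 := by
    rw [← Matrix.det_mul, h]
    exact hB.det_pos.ne'
  exact isUnit_iff_ne_zero.2 (right_ne_zero_of_mul h1)

/-- An invertible matrix as a continuous linear equivalence. -/
def actEquiv (A : Matrix (Fin k) (Fin k) ℝ) (h : IsUnit A.det) : E k ≃L[ℝ] E k :=
  ContinuousLinearEquiv.equivOfInverse (act A) (act A⁻¹)
    (fun v => by rw [← act_mul, Matrix.nonsing_inv_mul _ h, act_one])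
    (fun v => by rw [← act_mul, Matrix.mul_nonsing_inv _ h, act_one])

theorem act_hess {V : E k → EReal} (y v : E k) :
    act (hess V y) v = fderiv ℝ (gradient (re V)) y v := by
  ext i
  have hv : v = ∑ j, v j • EuclideanSpace.single j (1 : ℝ) := by
    ext l
    simp [Finset.sum_apply, Pi.single_apply]
  conv_rhs => rw [hv]
  rw [map_sum]
  simp only [map_smul]
  simp [hess, act, Matrix.mulVec, dotProduct, mul_comm]

/-- The factorization `Fᵀ F` itself supplies the symmetry of the Hessian. -/
theorem IsGammaSc2.hasExpansion {V : E k → EReal} (hV : IsGammaSc2 V) {y : E k}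
    (hy : y ∈ interior (dom V)) {F : Matrix (Fin k) (Fin k) ℝ}
    (hF : F.transpose * F = hess V y) :
    HasExpansion (fun z => re V z - inner ℝ z (gradient (re V) y)) y
      (fun v => ‖act F v‖ ^ 2) := by
  have h := hasExpansion_of_gradient (x := y) (g := re V) (G := gradient (re V))
    (B := fderiv ℝ (gradient (re V)) y)
    (by
      filter_upwards [isOpen_interior.mem_nhds hy] with z hz
      exact (hV.legendre.smooth.diff z hz).hasGradientAt)
    (hV.twice y hy).hasFDerivAt
    (fun u v => by
      rw [← act_hess, ← act_hess, inner_act, ← hF]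
      simp)
  convert h using 2 with v
  rw [← act_hess, ← hF, inner_act_gram]

end Matrices

/-! ### Derivatives of the quadratic family and the stationary branch `x_τ`. -/

namespace QuadData

variable {n m : ℕ} (P : QuadData n m)

/-- The linear map `δ ↦ ∑ δ_i (A_i x - b_i)`. -/
def slope (x : E n) : E m →L[ℝ] E n :=
  ∑ i : Fin m, (EuclideanSpace.proj i : E m →L[ℝ] ℝ).smulRight
    (act (P.A i.succ) x - P.b i.succ)

theorem slope_apply (x : E n) (δ : E m) :
    P.slope x δ = ∑ i : Fin m, δ i • (act (P.A i.succ) x - P.b i.succ) := by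
  simp [slope, sum_apply]

theorem J_apply (M : Matrix (Fin n) (Fin n) ℝ) (x : E n) (δ : E m) :
    P.J M x δ = act (M⁻¹).transpose (P.slope x δ) := by
  simp only [J, slope_apply, sum_apply, map_sum, map_smul, d]
  rfl

/-- The residual is affine in `τ` and vanishes at `σ`. -/
theorem residual (x : E n) {σ : E m} (h : act (P.Aσ σ) x = P.bσ σ) (τ : E m) :
    act (P.Aσ τ) x - P.bσ τ = P.slope x (τ - σ) := by
  have e : ∀ τ : E m, act (P.Aσ τ) x - P.bσ τ =
      act (P.A 0) x - P.b 0 + P.slope x τ := by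
    intro τ
    simp only [Aσ, bσ, slope_apply, act, map_add, map_sum, map_smul, add_apply, sum_apply,
      smul_apply, smul_sub, Finset.sum_sub_distrib]
    abel
  rw [map_sub, ← sub_eq_iff_eq_add'.2 (e τ).symm.symm, ← sub_eq_iff_eq_add'.2 (e σ).symm.symm, h]
  abel

theorem inner_A (k : Fin (m + 1)) (u v : E n) :
    inner ℝ (act (P.A k) u) v = inner ℝ u (act (P.A k) v) := by
  rw [inner_act, (P.symm k).eq]

theorem hasFDerivAt_quad (k : Fin (m + 1)) (x : E n) :
    HasFDerivAt (P.quad k) (innerSL ℝ (act (P.A k) x - P.b k)) x :=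
  hasFDerivAt_quadratic (P.inner_A k) (P.b k) (P.c k) x

/-- The rows of the Jacobian are the vectors `A_i x - b_i` that `slope` combines. This adjointness
is why `f` sees `H*` where `D` sees `H`. -/
theorem hasFDerivAt_q (x : E n) :
    HasFDerivAt P.q (ContinuousLinearMap.adjoint (P.slope x)) x := by
  rw [← hasFDerivWithinAt_univ, hasFDerivWithinAt_euclidean]
  intro i
  rw [hasFDerivWithinAt_univ]
  refine (P.hasFDerivAt_quad i.succ x).congr_fderiv ?_
  ext v
  have h : inner ℝ (EuclideanSpace.single i (1 : ℝ)) (ContinuousLinearMap.adjoint (P.slope x) v) =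
      inner ℝ (act (P.A i.succ) x - P.b i.succ) v := by
    rw [ContinuousLinearMap.adjoint_inner_right, slope_apply]
    simp [ite_smul]
  rw [EuclideanSpace.inner_single_left] at h
  simpa [inner_sub_left] using h.symm

theorem hasFDerivAt_L (x : E n) (σ : E m) :
    HasFDerivAt (fun y => P.L y σ) (innerSL ℝ (act (P.Aσ σ) x - P.bσ σ)) x := by
  simp only [L_eq]
  exact hasFDerivAt_quadratic (P.inner_Aσ σ) _ _ x

theorem L_add (x z : E n) (σ : E m) : P.L (x + z) σ =
    P.L x σ + inner ℝ (act (P.Aσ σ) x - P.bσ σ) z + 1 / 2 * inner ℝ z (act (P.Aσ σ) z) := by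
  simp only [L_eq]
  exact quadratic_add (P.inner_Aσ σ) _ _ x z

theorem L_sub (x : E n) (σ τ : E m) : P.L x τ = P.L x σ + inner ℝ (P.q x) (τ - σ) := by
  rw [L, L, inner_sub_right]
  ring

theorem continuous_act_Aσ : Continuous fun τ : E m => act (P.Aσ τ) := by
  simp only [Aσ, act, map_add, map_sum, map_smul]
  fun_prop

/-- The solution `y` of `A(τ) y = b(τ)` for `τ` near `σ`, if `A(σ) x = b(σ)` and `A(σ)` is
invertible. -/
def sol (x : E n) (σ τ : E m) : E n :=
  -- `Ring.inverse` is `0` at non-units, so the formula is meaningful only where `A(τ)` is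
  -- invertible.
  x - Ring.inverse (act (P.Aσ τ)) (P.slope x (τ - σ))

theorem sol_self (x : E n) (σ : E m) : P.sol x σ σ = x := by simp [sol]

variable {P} {x : E n} {σ : E m}

theorem eventually_isUnit (hu : IsUnit (act (P.Aσ σ))) : ∀ᶠ τ in 𝓝 σ, IsUnit (act (P.Aσ τ)) :=
  P.continuous_act_Aσ.continuousAt.eventually (Units.isOpen.mem_nhds hu)

theorem continuousAt_inverse (hu : IsUnit (act (P.Aσ σ))) :
    ContinuousAt (fun τ => Ring.inverse (act (P.Aσ τ))) σ := by
  obtain ⟨u, hu⟩ := hu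
  have h := NormedRing.inverse_continuousAt u
  rw [hu] at h
  exact ContinuousAt.comp (f := fun τ : E m => act (P.Aσ τ)) h P.continuous_act_Aσ.continuousAt

theorem act_sol (h : act (P.Aσ σ) x = P.bσ σ) {τ : E m} (hτ : IsUnit (act (P.Aσ τ))) :
    act (P.Aσ τ) (P.sol x σ τ) = P.bσ τ := by
  have e : act (P.Aσ τ) (Ring.inverse (act (P.Aσ τ)) (P.slope x (τ - σ))) =
      P.slope x (τ - σ) := by
    rw [← mul_apply_eq_comp, Ring.mul_inverse_cancel _ hτ]
    rfl
  rw [sol, map_sub, e, ← P.residual x h τ]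
  abel

theorem tendsto_sol (hu : IsUnit (act (P.Aσ σ))) : Tendsto (P.sol x σ) (𝓝 σ) (𝓝 x) := by
  have h : ContinuousAt (P.sol x σ) σ := by
    have h1 := continuousAt_inverse hu
    have h2 : ContinuousAt (fun τ => P.slope x (τ - σ)) σ := by fun_prop
    exact continuousAt_const.sub (h1.clm_apply h2)
  have := h.tendsto
  rwa [sol_self] at this

/-- With `r = slope x (τ - σ)`, the value is exactly `L(x,σ) + ⟨q(x), τ - σ⟩ - ½⟨r, A(τ)⁻¹ r⟩`. The
only error comes from replacing `A(τ)⁻¹` by `A(σ)⁻¹`, and `r = O(‖τ - σ‖)`. -/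
theorem hasExpansion_L_sol (h : act (P.Aσ σ) x = P.bσ σ) (hu : IsUnit (act (P.Aσ σ))) :
    HasExpansion (fun τ => P.L (P.sol x σ τ) τ - inner ℝ (P.q x) τ) σ
      (fun δ => -inner ℝ (P.slope x δ) (Ring.inverse (act (P.Aσ σ)) (P.slope x δ))) := by
  intro ε hε
  set C : ℝ := ‖P.slope x‖ with hC
  have hlim := (continuousAt_inverse hu).sub_const (Ring.inverse (act (P.Aσ σ)))
  have hlim := hlim.norm
  simp only [sub_self, norm_zero] at hlim
  filter_upwards [eventually_isUnit hu,
    hlim.eventually_lt_const (show 0 < ε / (C ^ 2 + 1) by positivity)] with τ hτ hsmall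
  set r := P.slope x (τ - σ) with hr
  have e1 : P.L (P.sol x σ τ) τ = P.L x σ + inner ℝ (P.q x) (τ - σ) -
      1 / 2 * inner ℝ r (Ring.inverse (act (P.Aσ τ)) r) := by
    have e : act (P.Aσ τ) (Ring.inverse (act (P.Aσ τ)) r) = r := by
      rw [← mul_apply_eq_comp, Ring.mul_inverse_cancel _ hτ]
      rfl
    rw [sol, sub_eq_add_neg, L_add, P.residual x h τ, ← hr, map_neg, e, inner_neg_neg,
      inner_neg_right, P.L_sub x σ τ, real_inner_comm r]
    ring
  have e2 : |inner ℝ r ((Ring.inverse (act (P.Aσ τ)) - Ring.inverse (act (P.Aσ σ))) r)| ≤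
      ε * ‖τ - σ‖ ^ 2 := by
    have hrn : ‖r‖ ≤ C * ‖τ - σ‖ := (P.slope x).le_opNorm _
    calc _ ≤ ‖r‖ * ‖(Ring.inverse (act (P.Aσ τ)) - Ring.inverse (act (P.Aσ σ))) r‖ :=
          abs_real_inner_le_norm _ _
      _ ≤ ‖r‖ * (ε / (C ^ 2 + 1) * ‖r‖) := by
          gcongr
          exact (ContinuousLinearMap.le_opNorm _ _).trans (by gcongr)
      _ = ε / (C ^ 2 + 1) * ‖r‖ ^ 2 := by ring
      _ ≤ ε / (C ^ 2 + 1) * (C * ‖τ - σ‖) ^ 2 := by gcongr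
      _ = ε * ‖τ - σ‖ ^ 2 * (C ^ 2 / (C ^ 2 + 1)) := by ring
      _ ≤ ε * ‖τ - σ‖ ^ 2 * 1 := by
          gcongr
          rw [div_le_one (by positivity)]
          linarith
      _ = _ := mul_one _
  rw [sub_apply, inner_sub_right] at e2
  have e3 : inner ℝ (P.q x) (τ - σ) = inner ℝ (P.q x) τ - inner ℝ (P.q x) σ :=
    inner_sub_right _ _ _
  rw [sol_self, e1, e3]
  rw [abs_le] at e2 ⊢
  have : 0 ≤ ε * ‖τ - σ‖ ^ 2 := by positivity
  constructor <;> linarith [e2.1, e2.2]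

end QuadData

/-! ### Norm bounds for an operator and its adjoint. -/

section LinearAlgebra

set_option linter.unusedSectionVars false

variable {X Y : Type*} [NormedAddCommGroup X] [InnerProductSpace ℝ X] [FiniteDimensional ℝ X]
  [NormedAddCommGroup Y] [InnerProductSpace ℝ Y] [FiniteDimensional ℝ Y]

/-- The value `‖K v‖` is determined by homogeneity from the unit sphere. -/
theorem norm_map_eq_mul_unit (K : X →L[ℝ] Y) {v : X} (hv : v ≠ 0) :
    ∃ u, ‖u‖ = 1 ∧ ‖K v‖ = ‖v‖ * ‖K u‖ := by
  have h0 : ‖v‖ ≠ 0 := norm_ne_zero_iff.2 hv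
  refine ⟨‖v‖⁻¹ • v, by simp [norm_smul, h0], ?_⟩
  rw [map_smul, norm_smul, norm_inv, norm_norm, mul_inv_cancel_left₀ h0]

theorem lt_norm_of_unit {K : X →L[ℝ] Y} (h : ∀ v, ‖v‖ = 1 → 1 < ‖K v‖) :
    ∀ v ≠ 0, ‖v‖ < ‖K v‖ := by
  intro v hv
  obtain ⟨u, hu, e⟩ := norm_map_eq_mul_unit K hv
  have := norm_pos_iff.2 hv
  nlinarith [h u hu]

theorem norm_lt_of_unit {K : X →L[ℝ] Y} (h : ∀ v, ‖v‖ = 1 → ‖K v‖ < 1) :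
    ∀ v ≠ 0, ‖K v‖ < ‖v‖ := by
  intro v hv
  obtain ⟨u, hu, e⟩ := norm_map_eq_mul_unit K hv
  have := norm_pos_iff.2 hv
  nlinarith [h u hu]

/-- This carries upper bounds from `H` to its adjoint. The adjoint enters only through the pairing
identity, so the roles of `H` and `Hs` can be exchanged. -/
theorem norm_adjoint_sq_le {H : X →L[ℝ] Y} {Hs : Y →L[ℝ] X}
    (hH : ∀ v u, inner ℝ (H v) u = inner ℝ v (Hs u)) (u : Y) :
    ‖Hs u‖ ^ 2 ≤ ‖H (Hs u)‖ * ‖u‖ := by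
  rw [← real_inner_self_eq_norm_sq, ← hH]
  exact real_inner_le_norm _ _

theorem norm_adjoint_le {H : X →L[ℝ] Y} {Hs : Y →L[ℝ] X}
    (hH : ∀ v u, inner ℝ (H v) u = inner ℝ v (Hs u)) (h : ∀ v, ‖H v‖ ≤ ‖v‖) (u : Y) :
    ‖Hs u‖ ≤ ‖u‖ := by
  rcases (norm_nonneg (Hs u)).eq_or_lt with h0 | h0
  · rw [← h0]; exact norm_nonneg _
  · refine le_of_mul_le_mul_left ?_ h0
    nlinarith [norm_adjoint_sq_le hH u, h (Hs u), norm_nonneg u]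

theorem norm_adjoint_lt {H : X →L[ℝ] Y} {Hs : Y →L[ℝ] X}
    (hH : ∀ v u, inner ℝ (H v) u = inner ℝ v (Hs u)) (h : ∀ v ≠ 0, ‖H v‖ < ‖v‖) :
    ∀ u ≠ 0, ‖Hs u‖ < ‖u‖ := by
  intro u hu
  have hu0 := norm_pos_iff.2 hu
  rcases eq_or_ne (Hs u) 0 with h0 | h0
  · rwa [h0, norm_zero]
  · have h1 := norm_pos_iff.2 h0
    refine lt_of_mul_lt_mul_left ?_ h1.le
    nlinarith [norm_adjoint_sq_le hH u, h _ h0]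

theorem injective_of_lower_bound {K : X →L[ℝ] Y} (h : ∀ v, ‖v‖ ≤ ‖K v‖) :
    Function.Injective K := by
  refine (injective_iff_map_eq_zero K).2 fun v hv => norm_le_zero_iff.1 ?_
  simpa [hv] using h v

/-- The orthogonal complement of the range lies in the kernel of the adjoint. -/
theorem surjective_of_adjoint_injective {H : X →L[ℝ] Y} {Hs : Y →L[ℝ] X}
    (hH : ∀ v u, inner ℝ (H v) u = inner ℝ v (Hs u)) (h : Function.Injective Hs) :
    Function.Surjective H := by
  have hr : (LinearMap.range (H : X →ₗ[ℝ] Y))ᗮ = ⊥ := by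
    refine (Submodule.eq_bot_iff _).2 fun u hu => h ?_
    rw [map_zero, ← inner_self_eq_zero (𝕜 := ℝ), ← hH]
    exact (Submodule.mem_orthogonal _ _).1 hu _ ⟨Hs u, rfl⟩
  exact LinearMap.range_eq_top.1 (Submodule.orthogonal_eq_bot_iff.1 hr)

theorem finrank_le_of_injective {K : X →L[ℝ] Y} (h : Function.Injective K) :
    Module.finrank ℝ X ≤ Module.finrank ℝ Y :=
  LinearMap.finrank_le_finrank_of_injective (f := (K : X →ₗ[ℝ] Y)) h

/-- For an eigenvector `v`, `‖H v‖² = μ‖v‖²`, while the lower bound at `H v` gives `‖H v‖ ≤ μ‖v‖`;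
hence `μ ≤ μ²`. -/
theorem one_le_eigenvalue {H : X →L[ℝ] Y} {Hs : Y →L[ℝ] X}
    (hH : ∀ v u, inner ℝ (H v) u = inner ℝ v (Hs u)) (h : ∀ u, ‖u‖ ≤ ‖Hs u‖) {μ : ℝ} (hμ : 0 < μ)
    (he : Module.End.HasEigenvalue (Hs.comp H : X →ₗ[ℝ] X) μ) : 1 ≤ μ := by
  obtain ⟨v, hv⟩ := he.exists_hasEigenvector
  have e : Hs (H v) = μ • v := hv.apply_eq_smul
  have hv0 : 0 < ‖v‖ := norm_pos_iff.2 hv.2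
  have h1 : ‖H v‖ ^ 2 = μ * ‖v‖ ^ 2 := by
    rw [← real_inner_self_eq_norm_sq, hH, e, inner_smul_right, real_inner_self_eq_norm_sq]
  have h2 : ‖H v‖ ≤ μ * ‖v‖ := by
    have := h (H v)
    rwa [e, norm_smul, Real.norm_of_nonneg hμ.le] at this
  have h3 : ‖H v‖ ^ 2 ≤ (μ * ‖v‖) ^ 2 := by gcongr
  rw [h1] at h3
  have h4 : 0 < μ * ‖v‖ ^ 2 := by positivity
  refine le_of_mul_le_mul_left ?_ h4
  linarith

theorem isGreatest_norm_sq (K : X →L[ℝ] Y) (hne : ∃ v : X, ‖v‖ = 1) :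
    IsGreatest {r | ∃ v, ‖v‖ = 1 ∧ r = ‖K v‖ ^ 2} (‖K‖ ^ 2) := by
  obtain ⟨w, hw⟩ := hne
  obtain ⟨u, hu, hmax⟩ := (isCompact_sphere (0 : X) 1).exists_isMaxOn ⟨w, by simpa using hw⟩
    (f := fun v => ‖K v‖) (by fun_prop)
  have hu1 : ‖u‖ = 1 := by simpa using hu
  have hle : ‖K‖ ≤ ‖K u‖ := by
    refine K.opNorm_le_bound (norm_nonneg _) fun v => ?_
    rcases eq_or_ne v 0 with rfl | hv
    · simp
    · obtain ⟨z, hz, e⟩ := norm_map_eq_mul_unit K hv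
      have : ‖K z‖ ≤ ‖K u‖ := hmax (show z ∈ _ by simpa using hz)
      rw [e, mul_comm]
      gcongr
  have hge : ∀ v, ‖v‖ = 1 → ‖K v‖ ≤ ‖K‖ := fun v hv => by simpa [hv] using K.le_opNorm v
  refine ⟨⟨u, hu1, by rw [le_antisymm hle (hge u hu1)]⟩, ?_⟩
  rintro r ⟨v, hv, rfl⟩
  have := hge v hv
  gcongr

theorem exists_ne_zero_map_eq_zero (K : X →L[ℝ] Y)
    (h : Module.finrank ℝ Y < Module.finrank ℝ X) : ∃ v ≠ 0, K v = 0 := by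
  by_contra! hne
  have hinj : Function.Injective K := (injective_iff_map_eq_zero K).2 fun v hv => by
    by_contra hv0
    exact hne v hv0 hv
  exact absurd (finrank_le_of_injective hinj) (not_le.2 h)

theorem le_norm_of_lt {K : X →L[ℝ] Y} (h : ∀ v ≠ 0, ‖v‖ < ‖K v‖) (v : X) : ‖v‖ ≤ ‖K v‖ := by
  rcases eq_or_ne v 0 with rfl | hv
  · simp
  · exact (h v hv).le

/-- Lower bounds pass to the adjoint once equal dimensions make `H` onto: for `u = H w`, `‖u‖² = ⟨w,
Hs u⟩ ≤ ‖w‖ ‖Hs u‖` and `‖w‖ < ‖u‖`. -/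
theorem lt_norm_adjoint {H : X →L[ℝ] Y} {Hs : Y →L[ℝ] X}
    (hH : ∀ v u, inner ℝ (H v) u = inner ℝ v (Hs u))
    (hdim : Module.finrank ℝ X = Module.finrank ℝ Y) (h : ∀ v ≠ 0, ‖v‖ < ‖H v‖) :
    ∀ u ≠ 0, ‖u‖ < ‖Hs u‖ := by
  have hinj := injective_of_lower_bound (le_norm_of_lt h)
  have hsurj : Function.Surjective (H : X →ₗ[ℝ] Y) :=
    (LinearMap.injective_iff_surjective_of_finrank_eq_finrank hdim).1 hinj
  intro u hu
  obtain ⟨w, hw⟩ := hsurj u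
  have hw : H w = u := hw
  have hw0 : w ≠ 0 := by
    rintro rfl
    exact hu (by rw [← hw, map_zero])
  have h1 := h w hw0
  rw [hw] at h1
  have h2 : ‖u‖ ^ 2 ≤ ‖w‖ * ‖Hs u‖ := by
    rw [← real_inner_self_eq_norm_sq]
    nth_rewrite 1 [← hw]
    rw [hH]
    exact real_inner_le_norm _ _
  by_contra! h3
  have := norm_pos_iff.2 hw0
  have := norm_pos_iff.2 hu
  nlinarith

end LinearAlgebra

/-! ### Second-order optimality conditions as norm comparisons. -/

section Local

variable {X Y : Type*} [NormedAddCommGroup X] [InnerProductSpace ℝ X] [FiniteDimensional ℝ X]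
  [NormedAddCommGroup Y] [InnerProductSpace ℝ Y]

/-- Second order optimality conditions in terms of the norm comparison `‖K ·‖` versus `‖·‖`, for an
extended-real-valued function that is finite near `x`. -/
theorem optimality_conditions {Φ : X → EReal} {g : X → ℝ} {S : Set X} {x : X} (hS : S ∈ 𝓝 x)
    (hΦ : ∀ᶠ y in 𝓝 x, Φ y = (g y : EReal)) (T : X ≃L[ℝ] X) (K : X →L[ℝ] Y)
    (hg : HasExpansion g x (fun v => ‖K (T v)‖ ^ 2 - ‖T v‖ ^ 2)) :
    (IsLocalMaxOn Φ S x → ∀ v, ‖K v‖ ≤ ‖v‖) ∧ (IsLocalMinOn Φ S x → ∀ v, ‖v‖ ≤ ‖K v‖) ∧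
    ((∀ v ≠ 0, ‖K v‖ < ‖v‖) → IsStrictLocalMaxOn Φ S x) ∧
    ((∀ v ≠ 0, ‖v‖ < ‖K v‖) → IsStrictLocalMinOn Φ S x) := by
  have hQ : ∀ (t : ℝ) (v : X), ‖K (T (t • v))‖ ^ 2 - ‖T (t • v)‖ ^ 2 =
      t ^ 2 * (‖K (T v)‖ ^ 2 - ‖T v‖ ^ 2) := fun t v => by
    simp only [map_smul, norm_smul, mul_pow, Real.norm_eq_abs, sq_abs]
    ring
  have hc : Continuous fun v => ‖K (T v)‖ ^ 2 - ‖T v‖ ^ 2 := by fun_prop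
  have hx := hΦ.self_of_nhds
  have hle : 𝓝[S \ {x}] x ≤ 𝓝[≠] x := nhdsWithin_mono _ fun y hy => hy.2
  refine ⟨fun h => ?_, fun h => ?_, fun h => ?_, fun h => ?_⟩
  · have hl : IsLocalMax g x := by
      have h' : ∀ᶠ y in 𝓝[S] x, Φ y ≤ Φ x := h
      rw [nhdsWithin_eq_nhds.2 hS] at h'
      filter_upwards [h', hΦ] with y h1 h2
      rwa [h2, hx, EReal.coe_le_coe_iff] at h1
    intro v
    by_contra! hv
    refine hg.not_isLocalMax hQ (v := T.symm v) ?_ hl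
    simp only [ContinuousLinearEquiv.apply_symm_apply, sub_pos]
    gcongr
  · have hl : IsLocalMin g x := by
      have h' : ∀ᶠ y in 𝓝[S] x, Φ x ≤ Φ y := h
      rw [nhdsWithin_eq_nhds.2 hS] at h'
      filter_upwards [h', hΦ] with y h1 h2
      rwa [h2, hx, EReal.coe_le_coe_iff] at h1
    intro v
    by_contra! hv
    refine hg.not_isLocalMin hQ (v := T.symm v) ?_ hl
    simp only [ContinuousLinearEquiv.apply_symm_apply, sub_neg]
    gcongr
  · filter_upwards [hle (hg.eventually_gt hc hQ fun v hv => by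
      have := h (T v) (by simpa using hv)
      rw [sub_neg]; gcongr), nhdsWithin_le_nhds hΦ] with y h1 h2
    rwa [h2, hx, EReal.coe_lt_coe_iff]
  · filter_upwards [hle (hg.eventually_lt hc hQ fun v hv => by
      have := h (T v) (by simpa using hv)
      rw [sub_pos]; gcongr), nhdsWithin_le_nhds hΦ] with y h1 h2
    rwa [h2, hx, EReal.coe_lt_coe_iff]

end Local

/-! ### Expansions of `f` and `D` at the critical point. -/

namespace QuadData

variable {n m : ℕ} {P : QuadData n m} {V : E m → EReal} {x : E n} {σ : E m}

theorem Xi_eq_coe (hV : IsGamma V) {τ : E m} (hτ : τ ∈ dom (conj V)) (y : E n) :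
    P.Xi V y τ = ((P.L y τ - re (conj V) τ : ℝ) : EReal) := by
  rw [Xi, ← hV.coe_re_conj hτ, EReal.coe_sub]

theorem f_eq_coe (hV : IsGamma V) {y : E n} (hy : P.q y ∈ dom V) :
    P.f V y = ((P.quad 0 y + re V (P.q y) : ℝ) : EReal) := by
  rw [f, ← hV.coe_re hy, EReal.coe_add]

theorem IsCritical.act_eq (hV : IsGamma V) (h : P.IsCritical V x σ) :
    act (P.Aσ σ) x = P.bσ σ := by
  have h1 : HasFDerivAt (fun y => (P.Xi V y σ).toReal) (0 : E n →L[ℝ] ℝ) x := by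
    have := h.2.comp x (hasFDerivAt_prodMk_left (𝕜 := ℝ) x σ)
    rwa [ContinuousLinearMap.zero_comp] at this
  have h2 : (fun y => (P.Xi V y σ).toReal) = fun y => P.L y σ - re (conj V) σ := by
    funext y
    rw [Xi_eq_coe hV (interior_subset h.1), EReal.toReal_coe]
  rw [h2] at h1
  have h3 := ((P.hasFDerivAt_L x σ).sub_const (re (conj V) σ)).unique h1
  have h4 := congrArg (fun g : E n →L[ℝ] ℝ => g (act (P.Aσ σ) x - P.bσ σ)) h3
  simp only [innerSL_apply_apply, zero_apply, inner_self_eq_zero] at h4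
  exact sub_eq_zero.1 h4

theorem IsCritical.hasFDerivAt_conj (hV : IsGamma V) (h : P.IsCritical V x σ) :
    HasFDerivAt (re (conj V)) (innerSL ℝ (P.q x)) σ := by
  have h1 : HasFDerivAt (fun τ => (P.Xi V x τ).toReal) (0 : E m →L[ℝ] ℝ) σ := by
    have := h.2.comp σ (hasFDerivAt_prodMk_right (𝕜 := ℝ) x σ)
    rwa [ContinuousLinearMap.zero_comp] at this
  have h2 : HasFDerivAt (fun τ => P.L x τ) (innerSL ℝ (P.q x)) σ :=
    (innerSL ℝ (P.q x)).hasFDerivAt.const_add (P.quad 0 x)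
  have h3 := h2.sub h1
  rw [sub_zero] at h3
  refine h3.congr_of_eventuallyEq ?_
  filter_upwards [isOpen_interior.mem_nhds h.1] with τ hτ
  change _ = P.L x τ - (P.Xi V x τ).toReal
  rw [Xi_eq_coe hV (interior_subset hτ), EReal.toReal_coe]
  ring

/-- Near a critical point of `Ξ` with `A(σ) ≺ 0`, both `f` and `D` are finite and have second order
expansions governed by `H*` and `H`, and a local maximum of `f` is one of `D`. -/
theorem local_analysis (hV : IsGammaSc2 V) (hx : x ∈ P.X0 V) (hσ : σ ∈ P.Sneg V)
    (hcrit : P.IsCritical V x σ)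
    {M : Matrix (Fin n) (Fin n) ℝ} (hM : M.transpose * M = -P.Aσ σ)
    {F : Matrix (Fin m) (Fin m) ℝ} (hF : F.transpose * F = hess V (P.q x)) :
    ∃ (fr : E n → ℝ) (Dr : E m → ℝ) (T : E n ≃L[ℝ] E n) (R : E m ≃L[ℝ] E m),
      (∀ᶠ y in 𝓝 x, P.f V y = (fr y : EReal)) ∧ (∀ᶠ τ in 𝓝 σ, P.D V τ = (Dr τ : EReal)) ∧
      P.Scol V ∈ 𝓝 σ ∧
      HasExpansion fr x (fun z =>
        ‖ContinuousLinearMap.adjoint (P.H M F x) (T z)‖ ^ 2 - ‖T z‖ ^ 2) ∧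
      HasExpansion Dr σ (fun δ => ‖P.H M F x (R δ)‖ ^ 2 - ‖R δ‖ ^ 2) ∧
      (IsLocalMax fr x → IsLocalMax Dr σ) := by
  have hG := hV.legendre.gamma
  have hMu : IsUnit M.det := isUnit_det_of_gram hM hσ.1
  have hFu : IsUnit F.det := isUnit_det_of_gram hF (hV.posDef _ hx)
  have hFtu : IsUnit (F.transpose).det := by rwa [Matrix.det_transpose]
  have hx : P.q x ∈ interior (dom V) := hx
  have hax := hcrit.act_eq hG
  have hVexp := hV.hasExpansion hx hF
  obtain ⟨hcs, hcd, hcexp⟩ := hG.hasExpansion_conj hx (actEquiv F hFu) hVexp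
  -- The expansions above are based at `∇V(q(x))`; this identity moves them to `σ`.
  have hgrad : σ = gradient (re V) (P.q x) :=
    hG.eq_of_hasFDerivAt_conj hx (hV.legendre.smooth.diff _ hx).hasGradientAt hcd.self_of_nhds hcs
      (interior_subset hcrit.1) (fun v => rfl) (hcrit.hasFDerivAt_conj hG)
  rw [← hgrad] at hVexp hcs hcd hcexp
  have hAu : IsUnit (act (P.Aσ σ)) := by
    have h1 : IsUnit (-P.Aσ σ) := by
      rw [Matrix.isUnit_iff_isUnit_det]
      exact isUnit_iff_ne_zero.2 hσ.1.det_pos.ne'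
    exact (IsUnit.neg_iff _).1 h1 |>.map (Matrix.toEuclideanCLM (n := Fin n) (𝕜 := ℝ))
  have hdomq : ∀ᶠ y in 𝓝 x, P.q y ∈ dom V := by
    filter_upwards [(P.hasFDerivAt_q x).continuousAt.eventually (isOpen_interior.mem_nhds hx)]
      with y hy using interior_subset hy
  have hR : ∀ δ, ContinuousLinearMap.adjoint ((actEquiv F hFu).symm : E m →L[ℝ] E m) δ =
      (actEquiv F.transpose hFtu).symm δ := by
    intro δ
    have : ((actEquiv F hFu).symm : E m →L[ℝ] E m) = act F⁻¹ := rfl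
    rw [this, adjoint_act, Matrix.transpose_nonsing_inv]
    rfl
  -- The coordinates `M z` and `(Fᵀ)⁻¹ δ` normalize the negative parts of the two quadratic forms to
  -- `-‖·‖²`.
  refine ⟨fun y => P.quad 0 y + re V (P.q y), fun τ => P.L (P.sol x σ τ) τ - re (conj V) τ,
    actEquiv M hMu, (actEquiv F.transpose hFtu).symm, ?_, ?_, ?_, ?_, ?_, ?_⟩
  · exact hdomq.mono fun y hy => f_eq_coe hG hy
  · filter_upwards [eventually_isUnit hAu, hcd] with τ h1 h2
    rw [P.D_eq V τ _ (act_sol hax h1), Xi_eq_coe hG h2]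
  · filter_upwards [eventually_isUnit hAu, hcd] with τ h1 h2
    exact ⟨⟨_, act_sol hax h1⟩, h2⟩
  · have h1 : HasExpansion (fun y => P.L y σ) x (fun z => -‖act M z‖ ^ 2) := by
      intro ε hε
      refine Eventually.of_forall fun y => ?_
      have e := P.L_add x (y - x) σ
      have e2 : inner ℝ (y - x) (act (P.Aσ σ) (y - x)) = -‖act M (y - x)‖ ^ 2 := by
        rw [← inner_act_gram, hM, act, act, map_neg, neg_apply, inner_neg_right, neg_neg]
      rw [add_sub_cancel, hax, sub_self, inner_zero_left, e2] at e
      beta_reduce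
      rw [e]
      simp only [add_zero, add_sub_cancel_left, sub_self, abs_zero]
      positivity
    have h2 := h1.add (hVexp.comp (act F) (P.hasFDerivAt_q x))
    convert h2 using 2 with y z
    · rw [L]; ring
    -- `H* M = F q'(x)`: the factor `M⁻¹` inside `H*` cancels.
    · have : ContinuousLinearMap.adjoint (P.H M F x) (actEquiv M hMu z) =
          act F (ContinuousLinearMap.adjoint (P.slope x) z) := by
        refine ext_inner_left ℝ fun w => ?_
        rw [ContinuousLinearMap.adjoint_inner_right, inner_act,
          ContinuousLinearMap.adjoint_inner_right]
        change inner ℝ (P.J M x (act F.transpose w)) (act M z) = _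
        rw [J_apply, ← inner_act, ← act_mul, Matrix.nonsing_inv_mul _ hMu, act_one]
      rw [this]
      change _ - ‖act M z‖ ^ 2 = _
      ring
  · have h2 := (hasExpansion_L_sol hax hAu).add hcexp.neg
    convert h2 using 2 with τ δ
    · ring
    · rw [hR]
      have e1 : P.H M F x ((actEquiv F.transpose hFtu).symm δ) =
          act (M⁻¹).transpose (P.slope x δ) := by
        rw [← J_apply]
        exact congrArg (P.J M x) ((actEquiv F.transpose hFtu).apply_symm_apply δ)
      -- From `A(σ) = -Mᵀ M`, the inverse is `-M⁻¹ (M⁻¹)ᵀ`, which turns the form into `‖J δ‖²`.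
      have e2 : Ring.inverse (act (P.Aσ σ)) (P.slope x δ) =
          -act M⁻¹ (act (M⁻¹).transpose (P.slope x δ)) := by
        have e3 : act (P.Aσ σ) (-act M⁻¹ (act (M⁻¹).transpose (P.slope x δ))) = P.slope x δ := by
          have : P.Aσ σ = -(M.transpose * M) := by rw [hM, neg_neg]
          rw [map_neg, ← act_mul, ← act_mul, this, Matrix.neg_mul, Matrix.neg_mul,
            Matrix.mul_assoc M.transpose, Matrix.mul_nonsing_inv _ hMu, Matrix.mul_one,
            Matrix.transpose_nonsing_inv, Matrix.mul_nonsing_inv _ (by rwa [Matrix.det_transpose])]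
          rw [act, map_neg, map_one]
          simp
        conv_lhs => rw [← e3]
        rw [← mul_apply_eq_comp, Ring.inverse_mul_cancel _ hAu]
        rfl
      rw [e1, e2, inner_neg_right, inner_act, real_inner_self_eq_norm_sq]
      ring
  -- `D(τ) = L(x_τ,τ) - V*(τ) ≤ f(x_τ) ≤ f(x) = D(σ)`, by Fenchel–Young and `x_τ → x`.
  · intro hmax
    filter_upwards [(tendsto_sol hAu).eventually hmax, (tendsto_sol hAu).eventually hdomq, hcd]
      with τ h1 h2 h3
    have h4 := hG.inner_sub_re_le h2 h3
    rw [sol_self]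
    simp only [L] at h4 ⊢
    rw [hcs]
    linarith

end QuadData

end CDT

end

/-! ### The four assertions. -/

open CDT in
theorem proposition5p1 {n m : ℕ} (hn : 0 < n) (hm : 0 < m)
    (P : QuadData n m) (V : CDT.E m → EReal) (hV : IsGammaSc2 V)
    (x : CDT.E n) (σ : CDT.E m) (hx : x ∈ P.X0 V) (hσ : σ ∈ P.Sneg V)
    (hcrit : P.IsCritical V x σ)
    (M : Matrix (Fin n) (Fin n) ℝ) (hM : M.transpose * M = -P.Aσ σ)
    (F : Matrix (Fin m) (Fin m) ℝ) (hF : F.transpose * F = hess V (P.q x))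
    (H : CDT.E m →L[ℝ] CDT.E n) (hH : H = P.H M F x)
    (Hs : CDT.E n →L[ℝ] CDT.E m) (hHs : Hs = ContinuousLinearMap.adjoint H) :
    -- (i)
    ((IsLocalMax (P.f V) x ∨ IsLocalMaxOn (P.D V) (P.Scol V) σ → ∀ v, ‖v‖ = 1 → ‖H v‖ ≤ 1) ∧
      (∃ β : ℝ, IsGreatest {r | ∃ u, ‖u‖ = 1 ∧ r = ‖Hs u‖ ^ 2} β ∧
        IsGreatest {r | ∃ v, ‖v‖ = 1 ∧ r = ‖H v‖ ^ 2} β ∧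
        ((∀ v, ‖v‖ = 1 → ‖H v‖ ≤ 1) ↔ β ≤ 1)) ∧
      ((∀ v, ‖v‖ = 1 → ‖H v‖ < 1) →
        IsStrictLocalMaxOn (P.f V) Set.univ x ∧ IsStrictLocalMaxOn (P.D V) (P.Scol V) σ) ∧
      (∀ i : Fin m, act (P.A i.succ) x = P.b i.succ ↔ P.d M x i = 0) ∧
      ((∀ i : Fin m, act (P.A i.succ) x = P.b i.succ) →
        IsStrictLocalMaxOn (P.f V) Set.univ x ∧ IsStrictLocalMaxOn (P.D V) (P.Scol V) σ)) ∧
    -- (ii)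
    ((IsLocalMin (P.f V) x →
        (∀ u, ‖u‖ = 1 → 1 ≤ ‖Hs u‖) ∧ Function.Surjective H ∧ n ≤ m ∧
        ∀ μ : ℝ, 0 < μ → Module.End.HasEigenvalue (Hs.comp H : CDT.E m →ₗ[ℝ] CDT.E m) μ →
          1 ≤ μ) ∧
      ((∀ u, ‖u‖ = 1 → 1 < ‖Hs u‖) →
        IsStrictLocalMinOn (P.f V) Set.univ x ∧
        (n < m → ¬ IsLocalExtrOn (P.D V) (P.Scol V) σ))) ∧
    -- (iii)
    ((IsLocalMinOn (P.D V) (P.Scol V) σ →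
        (∀ v, ‖v‖ = 1 → 1 ≤ ‖H v‖) ∧ Function.Injective H ∧ m ≤ n ∧
        (∀ μ : ℝ, 0 < μ → Module.End.HasEigenvalue (H.comp Hs : CDT.E n →ₗ[ℝ] CDT.E n) μ →
          1 ≤ μ) ∧
        (m < n → ¬ (∀ᶠ σ' in nhdsWithin σ (P.Scol V), P.D V σ' = P.D V σ) →
          ¬ IsLocalExtr (P.f V) x)) ∧
      ((∀ v, ‖v‖ = 1 → 1 < ‖H v‖) →
        IsStrictLocalMinOn (P.D V) (P.Scol V) σ ∧ (m < n → ¬ IsLocalExtr (P.f V) x))) ∧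
    -- (iv)
    (m = n → LinearIndependent ℝ (fun i : Fin m => act (P.A i.succ) x - P.b i.succ) →
      Submodule.span ℝ (Set.range fun i : Fin m => act (P.A i.succ) x - P.b i.succ) = ⊤ →
      (∀ v, ‖v‖ = 1 → 1 < ‖H v‖) →
        IsStrictLocalMinOn (P.f V) Set.univ x ∧ IsStrictLocalMinOn (P.D V) (P.Scol V) σ) := by
  obtain ⟨fr, Dr, T, R, hf, hD, hS, hfe, hDe, hdual⟩ :=
    QuadData.local_analysis hV hx hσ hcrit hM hF
  rw [← hH] at hDe
  rw [← hH, ← hHs] at hfe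
  obtain ⟨fmax, fmin, fsmax, fsmin⟩ := optimality_conditions univ_mem hf T Hs hfe
  obtain ⟨Dmax, Dmin, Dsmax, Dsmin⟩ := optimality_conditions hS hD R H hDe
  rw [isLocalMaxOn_univ_iff] at fmax
  rw [isLocalMinOn_univ_iff] at fmin
  have hadj : ∀ v u, inner ℝ (H v) u = inner ℝ v (Hs u) := fun v u => by
    rw [hHs, ContinuousLinearMap.adjoint_inner_right]
  have hadj' : ∀ u v, inner ℝ (Hs u) v = inner ℝ u (H v) := fun u v => by
    rw [real_inner_comm, ← hadj, real_inner_comm]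
  have hne : ∀ {k : ℕ}, 0 < k → ∃ v : CDT.E k, ‖v‖ = 1 := fun {k} hk =>
    ⟨EuclideanSpace.single ⟨0, hk⟩ 1, by simp⟩
  have hdual' : IsLocalMax (P.f V) x → IsLocalMaxOn (P.D V) (P.Scol V) σ := by
    intro h
    have h1 : IsLocalMax fr x := by
      filter_upwards [h, hf] with y h1 h2
      rwa [h2, hf.self_of_nhds, EReal.coe_le_coe_iff] at h1
    refine IsLocalMax.on ?_ _
    filter_upwards [hdual h1, hD] with τ h1 h2
    rwa [h2, hD.self_of_nhds, EReal.coe_le_coe_iff]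
  have strictMax : (∀ v ≠ 0, ‖H v‖ < ‖v‖) →
      IsStrictLocalMaxOn (P.f V) Set.univ x ∧ IsStrictLocalMaxOn (P.D V) (P.Scol V) σ :=
    fun h => ⟨fsmax (norm_adjoint_lt hadj h), Dsmax h⟩
  have hd : ∀ i : Fin m, act (P.A i.succ) x = P.b i.succ ↔ P.d M x i = 0 := by
    intro i
    have hMt : IsUnit M.transpose.det := by
      rw [Matrix.det_transpose]
      exact isUnit_det_of_gram hM hσ.1
    rw [QuadData.d, Matrix.transpose_nonsing_inv, ← sub_eq_zero]
    exact (map_eq_zero_iff (actEquiv M.transpose hMt).symm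
      (actEquiv M.transpose hMt).symm.injective).symm
  -- `Hs` has a nonzero kernel vector, along which the quadratic form of `f` is strictly negative.
  have notMinf : m < n → ¬ IsLocalMin (P.f V) x := fun hmn h => by
    obtain ⟨u, hu, hu0⟩ := exists_ne_zero_map_eq_zero Hs (by simpa using hmn)
    have := fmin h u
    rw [hu0, norm_zero] at this
    exact hu (norm_le_zero_iff.1 this)
  refine ⟨⟨?_, ?_, ?_, hd, ?_⟩, ⟨?_, ?_⟩, ⟨?_, ?_⟩, ?_⟩
  · rintro (h | h) v hv
    · exact hv ▸ norm_adjoint_le hadj' (fmax h) v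
    · exact hv ▸ Dmax h v
  · have hnorm : ‖Hs‖ = ‖H‖ := by rw [hHs, LinearIsometryEquiv.norm_map]
    have hg := isGreatest_norm_sq H (hne hm)
    refine ⟨‖H‖ ^ 2, hnorm ▸ isGreatest_norm_sq Hs (hne hn), hg, fun h => ?_, fun h v hv => ?_⟩
    · obtain ⟨v, hv, e⟩ := hg.1
      rw [e]
      exact pow_le_one₀ (norm_nonneg _) (h v hv)
    · have h1 : ‖H v‖ ^ 2 ≤ 1 := (hg.2 ⟨v, hv, rfl⟩).trans h
      exact (sq_le_one_iff₀ (norm_nonneg _)).1 h1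
  · exact fun h => strictMax (norm_lt_of_unit h)
  · intro h
    refine strictMax fun v hv => ?_
    have h0 : H v = 0 := by
      simp [hH, QuadData.H, QuadData.J, (hd _).1 (h _)]
    rw [h0, norm_zero]
    exact norm_pos_iff.2 hv
  · intro h
    have h1 := fmin h
    have hinj := injective_of_lower_bound h1
    exact ⟨fun u hu => hu ▸ h1 u, surjective_of_adjoint_injective hadj hinj,
      by simpa using finrank_le_of_injective hinj, fun μ hμ he => one_le_eigenvalue hadj h1 hμ he⟩
  · intro h
    have h1 := lt_norm_of_unit h
    refine ⟨fsmin h1, fun hnm => ?_⟩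
    rintro (hmin | hmax)
    · obtain ⟨v, hv, hv0⟩ := exists_ne_zero_map_eq_zero H (by simpa using hnm)
      have := Dmin hmin v
      rw [hv0, norm_zero] at this
      exact hv (norm_le_zero_iff.1 this)
    · obtain ⟨u, hu⟩ := hne hn
      have hu0 : u ≠ 0 := norm_ne_zero_iff.1 (by rw [hu]; exact one_ne_zero)
      exact (h1 u hu0).not_ge (norm_adjoint_le hadj (Dmax hmax) u)
  · intro h
    have h1 := Dmin h
    have hinj := injective_of_lower_bound h1
    refine ⟨fun v hv => hv ▸ h1 v, hinj, by simpa using finrank_le_of_injective hinj,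
      fun μ hμ he => one_le_eigenvalue hadj' h1 hμ he, fun hmn hconst => ?_⟩
    rintro (hmin | hmax)
    · exact notMinf hmn hmin
    -- Here `H` is an isometry and the quadratic form of `D` vanishes, so second-order information
    -- is void. The transfer from `f` makes `σ` a local maximizer as well as a minimizer of `D`, so
    -- `D` is locally constant.
    · refine hconst ?_
      filter_upwards [h, hdual' hmax] with τ h2 h3 using le_antisymm h3 h2
  · intro h
    have h1 := lt_norm_of_unit h
    refine ⟨Dsmin h1, fun hmn => ?_⟩
    rintro (hmin | hmax)
    · exact notMinf hmn hmin
    · obtain ⟨v, hv⟩ := hne hm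
      have hv0 : v ≠ 0 := norm_ne_zero_iff.1 (by rw [hv]; exact one_ne_zero)
      exact (h1 v hv0).not_ge (norm_adjoint_le hadj' (fmax hmax) v)
  · intro hmn _ _ h
    have h1 := lt_norm_of_unit h
    exact ⟨fsmin (lt_norm_adjoint hadj (by simpa using hmn) h1), Dsmin h1⟩
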